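/- **Setting.** For $n\ge 1$ and $0\le d\le n$ let $G^{\mathrm{bip}}_{n,d}$ be the random bipartite graph on parts $L,R$ of size $n$ each in which every pair in $L\times R$ is an edge independently with probability $d/n$; it is encoded by $A\in\{0,1\}^{n^2}$. A polynomial of degree (at most) $D$ is a map $f=(f_v)_{v\in L\cup R}:\mathbb R^{n^2}\to\mathbb R^{2n}$ whose coordinates are real polynomials of degree at most $D$; a random polynomial of degree $D$ is a family $f(\cdot,\omega)$ of such maps whose coefficients are random variables on a probability space $(\Omega,P)$, independent of $A$. For $\eta\ge 0$ put $I=\{v: f_v(A,\omega)\ge 1\}$, $\tilde I=\{v\in I: v\text{ has no neighbour in } I\}$, $J=\{v: \tfrac12<f_v(A,\omega)<1\}$, and let $V^\eta_f(A,\omega)=\tilde I$ if $|I\setminus\tilde I|+|J|\le\eta n$ and $V^\eta_f(A,\omega)=\varnothing$ otherwise. We say that $f$ $(k_\ell,k_r,\delta,\xi,\eta)$-optimizes the independent set problem in $G^{\mathrm{bip}}_{n,d}$ if, for $A\sim G^{\mathrm{bip}}_{n,d}$, $$\mathbb E_{A,\omega}\|f(A,\omega)\|^2\le\xi(k_\ell+k_r)\quad\text{and}\quad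 \mathbb P_{A,\omega}\big[|V^\eta_f\cap L|\ge k_\ell,\ |V^\eta_f\cap R|\ge k_r\big]\ge 1-\delta ,$$ where $\|\cdot\|$ is the Euclidean norm. **Theorem.** Let $\varepsilon>0$. (i) For every real $d>0$ there are $\xi\ge1$ and a sequence $\delta_n\in[0,1]$ with $\delta_n\to0$ such that for all $n\ge d$ and all real $k_\ell,k_r\ge0$ with $k_\ell+k_r\ge1$, $k_\ell\le(1-\varepsilon)\frac{\log d}{d}n$ and $k_r\le(1-\varepsilon)d^{\varepsilon-1}n$, there is a (deterministic) polynomial of degree at most $1$ that $(k_\ell,k_r,\delta_n,\xi,0)$-optimizes the independent set problem in $G^{\mathrm{bip}}_{n,d}$. (ii) There is $d_0>0$ such that for every real $d\ge d_0$ there are $n_0\in\mathbb N$ and $\eta,C_1,C_2>0$ such that for all $n\ge n_0$, all real $k_\ell,k_r$ with $\min\{k_\ell,k_r\}\ge(1+\varepsilon)\frac{\log d}{d}n$, all $\xi\ge1$, all integers $D$ with $1\le D\le\frac{C_1n}{\xi\log n}$ and all $0\le\delta\le\exp(-C_2\,\xi D\log n)$, no random polynomial of degree $D$ $(k_\ell,k_r,\delta,\xi,\eta)$-optimizes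 the independent set problem in $G^{\mathrm{bip}}_{n,d}$. -/

import Mathlib

open MeasureTheory ProbabilityTheory
open scoped ENNReal

noncomputable section

/-- The `2n` vertices: `Sum.inl i` are the vertices of `L`, `Sum.inr j` those of `R`. -/
abbrev BipVertex (n : ℕ) : Type := Fin n ⊕ Fin n

/-- The `n²` possible edges: `(i, j)` joins the `i`-th vertex of `L` to the `j`-th vertex of `R`. -/
abbrev BipEdge (n : ℕ) : Type := Fin n × Fin n

/-- The bipartite graph on `L ∪ R` whose edges are the pairs marked `true` by `A`. -/
def bipGraph {n : ℕ} (A : BipEdge n → Bool) : SimpleGraph (BipVertex n) where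
  Adj u v :=
    (∃ i j, u = Sum.inl i ∧ v = Sum.inr j ∧ A (i, j) = true) ∨
    (∃ i j, v = Sum.inl i ∧ u = Sum.inr j ∧ A (i, j) = true)
  symm := ⟨fun _ _ h => h.symm⟩
  loopless := ⟨fun u h => by
    rcases h with ⟨i, j, h1, h2, -⟩ | ⟨i, j, h1, h2, -⟩ <;> simp [h1] at h2⟩

/-- The 0/1 vector in `ℝ^(n²)` that encodes the edge set `A`. -/
def edgeVector {n : ℕ} (A : BipEdge n → Bool) : BipEdge n → ℝ :=
  fun e => if A e = true then 1 else 0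

/-- The edge probability `d / n`, truncated to `[0, 1]` (it equals `d / n` when `0 ≤ d ≤ n`). -/
def edgeProb (n : ℕ) (d : ℝ) : unitInterval :=
  Set.projIcc (0 : ℝ) 1 zero_le_one (d / n)

/-- The law of the random bipartite graph: every pair in `L × R` is an edge independently
with probability `d / n`. -/
def randomBip (n : ℕ) (d : ℝ) : Measure (BipEdge n → Bool) :=
  Measure.pi fun _ => bernoulliMeasure true false (edgeProb n d)

open Classical in
/-- `I`: the coordinates of the output `x` that are at least `1`. -/
def roundI {n : ℕ} (x : BipVertex n → ℝ) : Finset (BipVertex n) :=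
  Finset.univ.filter fun v => 1 ≤ x v

open Classical in
/-- The vertices of `I` without neighbours in `I`. -/
def roundITilde {n : ℕ} (A : BipEdge n → Bool) (x : BipVertex n → ℝ) : Finset (BipVertex n) :=
  (roundI x).filter fun v => ∀ w ∈ roundI x, ¬ (bipGraph A).Adj v w

open Classical in
/-- `J`: the coordinates of `x` that lie strictly between `1/2` and `1`. -/
def roundJ {n : ℕ} (x : BipVertex n → ℝ) : Finset (BipVertex n) :=
  Finset.univ.filter fun v => 1 / 2 < x v ∧ x v < 1

open Classical in
/-- The independent set `V^η` obtained by rounding the output `x` on the graph `A`. -/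
def roundedSet {n : ℕ} (η : ℝ) (A : BipEdge n → Bool) (x : BipVertex n → ℝ) :
    Finset (BipVertex n) :=
  if (((roundI x \ roundITilde A x).card + (roundJ x).card : ℕ) : ℝ) ≤ η * n
  then roundITilde A x else ∅

/-- `|S ∩ L|`. -/
def leftCard {n : ℕ} (S : Finset (BipVertex n)) : ℕ := (S.filter fun v => v.isLeft = true).card

/-- `|S ∩ R|`. -/
def rightCard {n : ℕ} (S : Finset (BipVertex n)) : ℕ := (S.filter fun v => v.isRight = true).card

/-- A vector of `2n` real polynomials in the `n²` edge variables. -/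
abbrev BipPoly (n : ℕ) : Type := BipVertex n → MvPolynomial (BipEdge n) ℝ

/-- The value of a polynomial vector at the 0/1 encoding of a graph. -/
def BipPoly.value {n : ℕ} (f : BipPoly n) (A : BipEdge n → Bool) : BipVertex n → ℝ :=
  fun v => MvPolynomial.eval (edgeVector A) (f v)

/-- Every coordinate polynomial has degree at most `D`. -/
def BipPoly.DegreeLE {n : ℕ} (f : BipPoly n) (D : ℕ) : Prop :=
  ∀ v, (f v).totalDegree ≤ D

/-- A random polynomial of degree at most `D`: each realization has degree at most `D`, and the
coefficients are random variables on `Ω`. -/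
structure IsRandomPoly {Ω : Type*} [MeasurableSpace Ω] {n : ℕ} (D : ℕ) (f : Ω → BipPoly n) :
    Prop where
  degreeLE : ∀ ω, (f ω).DegreeLE D
  measurable_coeff : ∀ v m, Measurable fun ω => (f ω v).coeff m

/-- `f` `(kl, kr, δ, ξ, η)`-optimizes the independent set problem in the random bipartite graph;
the graph `A` and the internal randomness `ω ∼ P` are independent. -/
def Optimizes {Ω : Type*} [MeasurableSpace Ω] (P : Measure Ω) (n : ℕ) (d kl kr δ ξ η : ℝ)
    (f : Ω → BipPoly n) : Prop :=
  (∫⁻ z, ENNReal.ofReal (∑ v, (f z.2).value z.1 v ^ 2) ∂((randomBip n d).prod P)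
      ≤ ENNReal.ofReal (ξ * (kl + kr))) ∧
  ENNReal.ofReal (1 - δ) ≤ ((randomBip n d).prod P)
    {z | kl ≤ leftCard (roundedSet η z.1 ((f z.2).value z.1)) ∧
         kr ≤ rightCard (roundedSet η z.1 ((f z.2).value z.1))}

/-- A deterministic polynomial optimizes, i.e. the internal randomness is trivial. -/
def DetOptimizes (n : ℕ) (d kl kr δ ξ η : ℝ) (F : BipPoly n) : Prop :=
  Optimizes (Measure.dirac ()) n d kl kr δ ξ η fun _ => F

end

/-! Below the threshold, fix a set `S` of `⌈kl⌉` left vertices and output it together with the right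
vertices of a fixed set `T` that have no neighbour in `S`. A right vertex is free with probability
`(1 - p) ^ s`, asymptotically at least `d ^ (ε - 1)`, and the number of free vertices concentrates
by Chebyshev. The linear form `1 - ∑ X (i, j)` equals `1` at a free vertex and is at most `0` at any
other vertex of `T`, so rounding makes no errors. Taking `T` no larger than needed keeps the norm of
order `kl + kr` (`degree_one_optimizes`).

Above the threshold the obstruction is an overlap gap along a path of correlated graphs. The
internal randomness is first fixed by averaging (`Optimizes.exists_realization`). The `n²` pairs are
then resampled one by one, in `K` cyclic sweeps, and every graph on this path has the original law.
A direction is bad at a graph if changing that pair moves `f` by more than order `n` in squared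
norm. The total influence of a degree `D` map is at most `D` times its second moment, so a
stationary path meets few bad directions on average, and an entropy form of Jensen's inequality
shows that it never moves along one with probability at least `exp (-C ξ D log n)`
(`exp_le_cubePr_avoidsBad`). The assumed failure probability is so much smaller that success at all
times can be required as well.

On that event the rounded sets have at least `s` vertices on both sides and lose at most `q`
vertices per step (`card_roundITilde_sdiff_le`). Compare them with the union `W` of sets recorded
earlier. Either the overlap with `W` drops, and at the first drop a set with moderately many new
vertices is recorded; or it stays large through a whole sweep, and `W` contains a large empty
rectangle all of whose bits are fresh (`exists_chain_of_stable`). First moments exclude both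
outcomes: each recorded set costs a factor `exp (-(ε ^ 2 / 16) l Φ)`, where `l = log d` and `Φ = (l
/ d) n`, so `K` of them outweigh the `exp (l Φ + 3 Φ)` choices of the initial set, while a fresh
rectangle is already too unlikely by itself (`cubePr_chain_le`, `SizeBounds.first_moment_le`). The
resulting upper bound `(K + 1) exp (-ε l Φ)` contradicts the lower bound when `D` is at most a small
multiple of `n / (ξ log n)`. -/

/-! ### Expectations under biased product measures on finite cubes -/

/-- The weight of a point of the cube under the product of Bernoulli measures of parameter `p`. -/
noncomputable def cubeWeight {ι : Type*} [Fintype ι] (p : ℝ) (x : ι → Bool) : ℝ :=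
  ∏ i, if x i = true then p else 1 - p

/-- Expectation with respect to the product of Bernoulli measures of parameter `p`. -/
noncomputable def cubeE {ι : Type*} [Fintype ι] [DecidableEq ι] (p : ℝ) (F : (ι → Bool) → ℝ) : ℝ :=
  ∑ x, cubeWeight p x * F x

open Classical in
/-- Probability with respect to the product of Bernoulli measures of parameter `p`. -/
noncomputable def cubePr {ι : Type*} [Fintype ι] [DecidableEq ι] (p : ℝ)
    (E : (ι → Bool) → Prop) : ℝ :=
  cubeE p fun x => if E x then 1 else 0

section Cube

lemma cubeWeight_nonneg {ι : Type*} [Fintype ι] {p : ℝ} (h0 : 0 ≤ p) (h1 : p ≤ 1) (x : ι → Bool) :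
    0 ≤ cubeWeight p x :=
  Finset.prod_nonneg fun i _ => by split_ifs <;> linarith

variable {ι κ : Type*} [Fintype ι] [DecidableEq ι] [Fintype κ] [DecidableEq κ] {p : ℝ}

lemma cubeE_prod (g : ι → Bool → ℝ) :
    cubeE p (fun x => ∏ i, g i (x i)) = ∏ i, (p * g i true + (1 - p) * g i false) := by
  have h := Finset.prod_univ_sum (fun _ : ι => (Finset.univ : Finset Bool))
    (fun i b => (if b = true then p else 1 - p) * g i b)
  simp only [Fintype.sum_bool, if_true, Fintype.piFinset_univ, Finset.prod_mul_distrib] at h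
  simpa [cubeE, cubeWeight] using h.symm

lemma cubeE_const (c : ℝ) : cubeE p (fun _ : ι → Bool => c) = c := by
  have h := cubeE_prod (ι := ι) (p := p) (fun _ _ => 1)
  simp only [cubeE, Finset.prod_const_one, mul_one, add_sub_cancel] at h
  simp [cubeE, ← Finset.sum_mul, h]

lemma cubeE_add (F G : (ι → Bool) → ℝ) :
    cubeE p (fun x => F x + G x) = cubeE p F + cubeE p G := by
  simp [cubeE, mul_add, Finset.sum_add_distrib]

lemma cubeE_sub (F G : (ι → Bool) → ℝ) :
    cubeE p (fun x => F x - G x) = cubeE p F - cubeE p G := by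
  simp [cubeE, mul_sub, Finset.sum_sub_distrib]

lemma cubeE_mul_left (c : ℝ) (F : (ι → Bool) → ℝ) :
    cubeE p (fun x => c * F x) = c * cubeE p F := by
  simp only [cubeE, Finset.mul_sum]
  exact Finset.sum_congr rfl fun x _ => by ring

lemma cubeE_sum {α : Type*} (s : Finset α) (F : α → (ι → Bool) → ℝ) :
    cubeE p (fun x => ∑ a ∈ s, F a x) = ∑ a ∈ s, cubeE p (F a) := by
  simp only [cubeE, Finset.mul_sum]
  exact Finset.sum_comm

lemma cubeE_mono (h0 : 0 ≤ p) (h1 : p ≤ 1) {F G : (ι → Bool) → ℝ} (h : ∀ x, F x ≤ G x) :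
    cubeE p F ≤ cubeE p G :=
  Finset.sum_le_sum fun x _ => mul_le_mul_of_nonneg_left (h x) (cubeWeight_nonneg h0 h1 x)

lemma cubeE_nonneg (h0 : 0 ≤ p) (h1 : p ≤ 1) {F : (ι → Bool) → ℝ} (h : ∀ x, 0 ≤ F x) :
    0 ≤ cubeE p F :=
  Finset.sum_nonneg fun x _ => mul_nonneg (cubeWeight_nonneg h0 h1 x) (h x)

lemma cubeE_congr_equiv (e : ι ≃ κ) (F : (κ → Bool) → ℝ) :
    cubeE p (fun x : ι → Bool => F (x ∘ e.symm)) = cubeE p F := by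
  refine Fintype.sum_equiv (e.arrowCongr (Equiv.refl Bool)) _ _ fun x => ?_
  have : (e.arrowCongr (Equiv.refl Bool)) x = x ∘ e.symm := by ext; simp
  rw [this]
  congr 1
  exact Fintype.prod_equiv e _ _ fun i => by simp

lemma cubeE_sum_type (F : (ι ⊕ κ → Bool) → ℝ) :
    cubeE p F = cubeE p fun x => cubeE p fun y => F (Sum.elim x y) := by
  simp only [cubeE, Finset.mul_sum]
  rw [← Fintype.sum_prod_type']
  refine Fintype.sum_equiv (Equiv.sumArrowEquivProdArrow ι κ Bool) _ _ fun x => ?_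
  have : Sum.elim ((Equiv.sumArrowEquivProdArrow ι κ Bool) x).1
      ((Equiv.sumArrowEquivProdArrow ι κ Bool) x).2 = x := by
    ext (i | i) <;> rfl
  rw [this, ← mul_assoc]
  congr 1
  simp only [cubeWeight, Fintype.prod_sum_type]
  rfl

/-- Restricting a product measure along an injection of index sets gives a product measure. -/
lemma cubeE_comp_injective {g : ι → κ} (hg : Function.Injective g) (F : (ι → Bool) → ℝ) :
    cubeE p (fun y : κ → Bool => F (y ∘ g)) = cubeE p F := by
  classical
  let e : ι ⊕ ((Set.range g)ᶜ : Set κ) ≃ κ :=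
    (Equiv.sumCongr (Equiv.ofInjective g hg) (Equiv.refl _)).trans (Equiv.Set.sumCompl _)
  have he : ∀ i, e (Sum.inl i) = g i := fun i => by simp [e]
  rw [← cubeE_congr_equiv e, cubeE_sum_type]
  have : ∀ (x : ι → Bool) (y : ((Set.range g)ᶜ : Set κ) → Bool),
      (Sum.elim x y ∘ e.symm) ∘ g = x := by
    intro x y
    ext i
    simp [← he]
  simp only [this, cubeE_const]

lemma cubePr_forall_false (U : Finset ι) :
    cubePr p (fun x => ∀ u ∈ U, x u = false) = (1 - p) ^ U.card := by
  classical
  have h := cubeE_prod (p := p) (fun i b => if i ∈ U then (if b = false then (1 : ℝ) else 0) else 1)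
  have h1 : ∀ x : ι → Bool, (∏ i, if i ∈ U then (if x i = false then (1 : ℝ) else 0) else 1) =
      if ∀ u ∈ U, x u = false then 1 else 0 := by
    intro x
    rw [Finset.prod_ite_mem, Finset.univ_inter, Finset.prod_ite_zero]
    simp
  simp only [h1] at h
  rw [cubePr]
  refine Eq.trans ?_ (h.trans ?_)
  · congr
    ext x
    congr
  rw [← Finset.prod_const, ← Finset.prod_subset (Finset.subset_univ U)]
  · exact Finset.prod_congr rfl fun i hi => by simp [hi]
  · intro i _ hi
    simp [hi]

/-- Resampling one coordinate does not change the expectation. -/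
lemma cubeE_resample (i : ι) (F : (ι → Bool) → ℝ) :
    cubeE p F = cubeE p fun x =>
      p * F (Function.update x i true) + (1 - p) * F (Function.update x i false) := by
  have hflip : Function.Involutive fun x : ι → Bool => Function.update x i (!x i) := by
    intro x; simp
  -- The flip at `i` pairs the points differing only there; on each pair the claim is a two-term
  -- identity.
  have hdouble : ∀ G : (ι → Bool) → ℝ,
      2 * ∑ x, G x = ∑ x, (G x + G (Function.update x i (!x i))) := by
    intro G
    rw [Finset.sum_add_distrib, two_mul]
    congr 1
    exact (Fintype.sum_equiv hflip.toPerm _ _ fun x => rfl).symm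
  have hw : ∀ (x : ι → Bool) (b : Bool), cubeWeight p (Function.update x i b) =
      (if b = true then p else 1 - p) *
        ∏ j ∈ Finset.univ.erase i, if x j = true then p else 1 - p := by
    intro x b
    rw [cubeWeight, ← Finset.mul_prod_erase _ _ (Finset.mem_univ i)]
    congr 1
    · simp
    · refine Finset.prod_congr rfl fun j hj => ?_
      rw [Function.update_of_ne (Finset.ne_of_mem_erase hj)]
  have h2 : 2 * cubeE p F = 2 * cubeE p fun x =>
      p * F (Function.update x i true) + (1 - p) * F (Function.update x i false) := by
    rw [cubeE, cubeE, hdouble, hdouble]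
    refine Finset.sum_congr rfl fun x _ => ?_
    have hx : cubeWeight p x = cubeWeight p (Function.update x i (x i)) := by simp
    have hxF : F x = F (Function.update x i (x i)) := by simp
    rw [hx, hxF, hw, hw]
    cases x i <;> simp <;> ring
  linarith

lemma cubePr_markov (h0 : 0 ≤ p) (h1 : p ≤ 1) {F : (ι → Bool) → ℝ} (hF : ∀ x, 0 ≤ F x)
    {c : ℝ} (hc : 0 < c) : cubePr p (fun x => c ≤ F x) ≤ cubeE p F / c := by
  classical
  rw [le_div_iff₀ hc, mul_comm, cubePr, ← cubeE_mul_left]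
  refine cubeE_mono h0 h1 fun x => ?_
  split_ifs with h
  · simpa using h
  · simpa using hF x

lemma cubePr_mono (h0 : 0 ≤ p) (h1 : p ≤ 1) {E E' : (ι → Bool) → Prop} (h : ∀ x, E x → E' x) :
    cubePr p E ≤ cubePr p E' := by
  classical
  refine cubeE_mono h0 h1 fun x => ?_
  by_cases hx : E x
  · simp [hx, h x hx]
  · by_cases hx' : E' x <;> simp [hx, hx']

lemma cubePr_nonneg (h0 : 0 ≤ p) (h1 : p ≤ 1) (E : (ι → Bool) → Prop) : 0 ≤ cubePr p E := by
  classical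
  exact cubeE_nonneg h0 h1 fun x => by split_ifs <;> norm_num

lemma cubePr_not (E : (ι → Bool) → Prop) : cubePr p (fun x => ¬ E x) = 1 - cubePr p E := by
  classical
  have h1 := cubeE_const (ι := ι) (p := p) 1
  rw [cubePr, cubePr, eq_sub_iff_add_eq, ← cubeE_add]
  refine Eq.trans ?_ h1
  congr 1
  ext x
  by_cases h : E x <;> simp [h]

lemma cubePr_or_le (h0 : 0 ≤ p) (h1 : p ≤ 1) (E E' : (ι → Bool) → Prop) :
    cubePr p (fun x => E x ∨ E' x) ≤ cubePr p E + cubePr p E' := by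
  classical
  rw [cubePr, cubePr, cubePr, ← cubeE_add]
  refine cubeE_mono h0 h1 fun x => ?_
  by_cases h : E x <;> by_cases h' : E' x <;> simp [h, h']

lemma cubePr_exists_le (h0 : 0 ≤ p) (h1 : p ≤ 1) {α : Type*} (s : Finset α)
    (E : α → (ι → Bool) → Prop) :
    cubePr p (fun x => ∃ a ∈ s, E a x) ≤ ∑ a ∈ s, cubePr p (E a) := by
  classical
  simp only [cubePr]
  rw [← cubeE_sum]
  refine cubeE_mono h0 h1 fun x => ?_
  split_ifs with h
  · obtain ⟨a, ha, hx⟩ := h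
    have := Finset.single_le_sum (f := fun a => if E a x then (1 : ℝ) else 0)
      (fun b _ => by split_ifs <;> norm_num) ha
    simpa [hx] using this
  · exact Finset.sum_nonneg fun b _ => by split_ifs <;> norm_num

lemma exists_of_cubePr_pos {E : (ι → Bool) → Prop} (h : 0 < cubePr p E) : ∃ x, E x := by
  classical
  by_contra hne
  push Not at hne
  simp [cubePr, hne, cubeE_const] at h

end Cube

/-! ### Low-degree functions on the biased cube and their total influence -/

/-- The character `∏ i ∈ S, (x i - p)`. -/
noncomputable def cubeChar {ι : Type*} (p : ℝ) (S : Finset ι) (x : ι → Bool) : ℝ :=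
  ∏ i ∈ S, ((if x i = true then 1 else 0) - p)

/-- The discrete derivative in direction `i`. -/
def cubeDeriv {ι : Type*} [DecidableEq ι] (i : ι) (f : (ι → Bool) → ℝ) (x : ι → Bool) : ℝ :=
  f (Function.update x i true) - f (Function.update x i false)

/-- `f` is a combination of characters of sets of at most `D` elements. -/
def IsLowDegree {ι : Type*} [Fintype ι] (p : ℝ) (D : ℕ) (f : (ι → Bool) → ℝ) : Prop :=
  ∃ c : Finset ι → ℝ,
    ∀ x, f x = ∑ S ∈ Finset.univ.filter (fun S : Finset ι => S.card ≤ D), c S * cubeChar p S x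

section Influence

variable {ι : Type*} [Fintype ι] [DecidableEq ι] {p : ℝ}

/-- The expectation factors over coordinates, and a coordinate in exactly one of `S`, `T`
contributes `E (x i - p) = 0`. The characters are not normalised, so each common element leaves a
variance `p (1 - p)`. -/
lemma cubeE_char_mul_char (S T : Finset ι) :
    cubeE p (fun x => cubeChar p S x * cubeChar p T x) =
      if S = T then (p * (1 - p)) ^ S.card else 0 := by
  have h := cubeE_prod (p := p) (fun (i : ι) b =>
    (if i ∈ S then ((if b = true then (1 : ℝ) else 0) - p) else 1) *
      (if i ∈ T then ((if b = true then (1 : ℝ) else 0) - p) else 1))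
  simp only [Finset.prod_mul_distrib, Finset.prod_ite_mem, Finset.univ_inter] at h
  simp only [cubeChar]
  rw [h]
  by_cases hST : S = T
  · rw [if_pos hST]
    subst hST
    rw [← Finset.prod_const, ← Finset.prod_subset (Finset.subset_univ S)]
    · refine Finset.prod_congr rfl fun i hi => ?_
      simp [hi]
      ring
    · intro i _ hi
      simp [hi]
  · rw [if_neg hST]
    obtain ⟨i, hi⟩ : ∃ i, ¬ (i ∈ S ↔ i ∈ T) := by
      by_contra hcon
      push Not at hcon
      exact hST (Finset.ext hcon)
    refine Finset.prod_eq_zero (Finset.mem_univ i) ?_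
    by_cases h1 : i ∈ S <;> by_cases h2 : i ∈ T <;> simp [h1, h2] at hi ⊢ <;> ring

/-- Parseval, with an injective relabelling `h` so that it also applies to derivatives (`S ↦ S.erase
i`) and to neighbour counts (singletons). -/
lemma cubeE_sq_sum_char {α : Type*} [DecidableEq α] (A : Finset α) (c : α → ℝ) (h : α → Finset ι)
    (hinj : Set.InjOn h A) :
    cubeE p (fun x => (∑ a ∈ A, c a * cubeChar p (h a) x) ^ 2) =
      ∑ a ∈ A, c a ^ 2 * (p * (1 - p)) ^ (h a).card := by
  have h1 : ∀ x, (∑ a ∈ A, c a * cubeChar p (h a) x) ^ 2 =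
      ∑ a ∈ A, ∑ b ∈ A, (c a * c b) * (cubeChar p (h a) x * cubeChar p (h b) x) := by
    intro x
    rw [sq, Finset.sum_mul_sum]
    exact Finset.sum_congr rfl fun a _ => Finset.sum_congr rfl fun b _ => by ring
  simp only [h1, cubeE_sum, cubeE_mul_left, cubeE_char_mul_char]
  refine Finset.sum_congr rfl fun a ha => ?_
  rw [Finset.sum_eq_single a]
  · simp [sq]
  · intro b hb hab
    have : h a ≠ h b := fun hh => hab (hinj ha hb hh).symm
    simp [this]
  · intro h'; exact absurd ha h'

lemma cubeDeriv_char {ι : Type*} [DecidableEq ι] {p : ℝ} (i : ι) (S : Finset ι) (x : ι → Bool) :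
    cubeDeriv i (cubeChar p S) x = if i ∈ S then cubeChar p (S.erase i) x else 0 := by
  simp only [cubeDeriv, cubeChar]
  split_ifs with hi
  · rw [← Finset.mul_prod_erase S _ hi, ← Finset.mul_prod_erase S _ hi]
    have : ∀ b, (∏ j ∈ S.erase i, ((if Function.update x i b j = true then (1 : ℝ) else 0) - p)) =
        ∏ j ∈ S.erase i, ((if x j = true then (1 : ℝ) else 0) - p) := fun b =>
      Finset.prod_congr rfl fun j hj => by
        rw [Function.update_of_ne (Finset.ne_of_mem_erase hj)]
    rw [this, this]
    simp
    ring
  · have : ∀ b, (∏ j ∈ S, ((if Function.update x i b j = true then (1 : ℝ) else 0) - p)) =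
        ∏ j ∈ S, ((if x j = true then (1 : ℝ) else 0) - p) := fun b =>
      Finset.prod_congr rfl fun j hj => by
        rw [Function.update_of_ne (show j ≠ i from fun h => hi (h ▸ hj))]
    rw [this, this, sub_self]

/-- The total influence of a function of degree `D` is at most `D` times its second moment. -/
lemma IsLowDegree.total_influence_le (h0 : 0 ≤ p) (h1 : p ≤ 1) {D : ℕ} {f : (ι → Bool) → ℝ}
    (hf : IsLowDegree p D f) :
    ∑ i, p * (1 - p) * cubeE p (fun x => cubeDeriv i f x ^ 2) ≤
      D * cubeE p (fun x => f x ^ 2) := by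
  obtain ⟨c, hc⟩ := hf
  set 𝒮 := Finset.univ.filter (fun S : Finset ι => S.card ≤ D) with h𝒮
  have hD : ∀ S ∈ 𝒮, S.card ≤ D := fun S hS => (Finset.mem_filter.1 hS).2
  clear_value 𝒮
  have hv : 0 ≤ p * (1 - p) := mul_nonneg h0 (by linarith)
  have hsq : cubeE p (fun x => f x ^ 2) = ∑ S ∈ 𝒮, c S ^ 2 * (p * (1 - p)) ^ S.card := by
    simp only [hc]
    exact cubeE_sq_sum_char 𝒮 c id (Function.injective_id.injOn)
  have hder : ∀ i x, cubeDeriv i f x =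
      ∑ S ∈ 𝒮.filter (fun S => i ∈ S), c S * cubeChar p (S.erase i) x := by
    intro i x
    have : cubeDeriv i f x = ∑ S ∈ 𝒮, c S * cubeDeriv i (cubeChar p S) x := by
      simp only [cubeDeriv, hc, ← Finset.sum_sub_distrib, mul_sub]
    rw [this, Finset.sum_filter]
    refine Finset.sum_congr rfl fun S _ => ?_
    rw [cubeDeriv_char]
    split_ifs <;> simp
  -- Differentiating removes `i` and hence one factor `p (1 - p)`; the prefactor restores it, so `S`
  -- contributes its full Fourier weight once for each of its at most `D` elements.
  have hinf : ∀ i, p * (1 - p) * cubeE p (fun x => cubeDeriv i f x ^ 2) =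
      ∑ S ∈ 𝒮, if i ∈ S then c S ^ 2 * (p * (1 - p)) ^ S.card else 0 := by
    intro i
    simp only [hder]
    rw [cubeE_sq_sum_char _ c (fun S => S.erase i), Finset.mul_sum, Finset.sum_filter]
    · refine Finset.sum_congr rfl fun S _ => ?_
      split_ifs with hi
      · rw [← Finset.card_erase_add_one hi, pow_succ]
        ring
      · rfl
    · intro S hS T hT hST
      simp only [Finset.coe_filter, Set.mem_ofPred_eq] at hS hT
      dsimp only at hST
      rw [← Finset.insert_erase hS.2, ← Finset.insert_erase hT.2, hST]
  simp only [hinf]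
  rw [Finset.sum_comm, hsq, Finset.mul_sum]
  refine Finset.sum_le_sum fun S hS => ?_
  rw [← Finset.sum_filter, Finset.sum_const, nsmul_eq_mul]
  have hcard : (Finset.univ.filter fun i => i ∈ S).card ≤ D := by
    simpa using hD S hS
  exact mul_le_mul_of_nonneg_right (by exact_mod_cast hcard)
    (mul_nonneg (sq_nonneg _) (pow_nonneg hv _))

lemma IsLowDegree.sum {ι α : Type*} [Fintype ι] {p : ℝ} (A : Finset α) {D : ℕ} {f : α → (ι → Bool) → ℝ}
    (hf : ∀ a ∈ A, IsLowDegree p D (f a)) : IsLowDegree p D (fun x => ∑ a ∈ A, f a x) := by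
  classical
  have : ∀ a, ∃ c : Finset ι → ℝ, a ∈ A → ∀ x, f a x =
      ∑ S ∈ Finset.univ.filter (fun S : Finset ι => S.card ≤ D), c S * cubeChar p S x := by
    intro a
    by_cases ha : a ∈ A
    · obtain ⟨c, hc⟩ := hf a ha
      exact ⟨c, fun _ => hc⟩
    · exact ⟨0, fun h => absurd h ha⟩
  choose c hc using this
  refine ⟨fun S => ∑ a ∈ A, c a S, fun x => ?_⟩
  simp only [Finset.sum_mul]
  rw [Finset.sum_comm]
  exact Finset.sum_congr rfl fun a ha => hc a ha x

/-- Expand each factor as `x i = (x i - p) + p`; only characters of subsets of `S` appear. -/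
lemma isLowDegree_const_mul_prod {D : ℕ} (a : ℝ) (S : Finset ι) (hS : S.card ≤ D) :
    IsLowDegree p D (fun x => a * ∏ i ∈ S, if x i = true then (1 : ℝ) else 0) := by
  refine ⟨fun T => if T ⊆ S then a * p ^ (S \ T).card else 0, fun x => ?_⟩
  have h1 : (∏ i ∈ S, if x i = true then (1 : ℝ) else 0) =
      ∑ T ∈ S.powerset, cubeChar p T x * p ^ (S \ T).card := by
    simp only [cubeChar, ← Finset.prod_const]
    rw [← Finset.prod_add]
    exact Finset.prod_congr rfl fun i _ => by ring
  dsimp only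
  rw [h1, Finset.mul_sum]
  simp only [ite_mul, zero_mul]
  rw [← Finset.sum_filter, Finset.filter_filter]
  refine Finset.sum_congr ?_ fun T _ => by ring
  ext T
  simp only [Finset.mem_powerset, Finset.mem_filter, Finset.mem_univ, true_and]
  exact ⟨fun h => ⟨(Finset.card_le_card h).trans hS, h⟩, fun h => h.2⟩

/-- A real polynomial of total degree at most `D` restricts to a low-degree function. -/
lemma isLowDegree_eval {D : ℕ} (F : MvPolynomial ι ℝ) (hF : F.totalDegree ≤ D) :
    IsLowDegree p D fun x : ι → Bool =>
      MvPolynomial.eval (fun i => if x i = true then (1 : ℝ) else 0) F := by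
  simp only [MvPolynomial.eval_eq]
  refine IsLowDegree.sum _ fun m hm => ?_
  -- On 0/1 points positive powers of a variable equal the variable, so only the support of a
  -- monomial matters.
  have hcard : m.support.card ≤ D := by
    refine le_trans ?_ ((MvPolynomial.le_totalDegree hm).trans hF)
    rw [Finset.card_eq_sum_ones]
    exact Finset.sum_le_sum fun i hi => Nat.one_le_iff_ne_zero.2 (Finsupp.mem_support_iff.1 hi)
  have h := isLowDegree_const_mul_prod (p := p) (F.coeff m) m.support hcard
  convert h using 4 with x i hi
  split_ifs
  · simp
  · exact zero_pow (Finsupp.mem_support_iff.1 hi)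

end Influence

/-! ### The resampling path and its small jumps -/

/-- The last time `≤ t` at which the coordinate `e` was resampled, when coordinate `σ j` is
resampled at time `j + 1`. -/
def lastTime {E : Type*} [DecidableEq E] (σ : ℕ → E) : ℕ → E → ℕ
  | 0 => fun _ => 0
  | t + 1 => Function.update (lastTime σ t) (σ t) (t + 1)

/-- The independent bit that coordinate `e` of the path shows at time `t`. -/
def pathCoord {E : Type*} [DecidableEq E] (T : ℕ) (σ : ℕ → E) (t : ℕ) (e : E) : Fin (T + 1) × E :=
  (Fin.ofNat (T + 1) (lastTime σ t e), e)

/-- The state at time `t` of the path that resamples coordinate `σ j` at time `j + 1`. -/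
def pathState {E : Type*} [DecidableEq E] {T : ℕ} (σ : ℕ → E) (ω : Fin (T + 1) × E → Bool) (t : ℕ) :
    E → Bool :=
  fun e => ω (pathCoord T σ t e)

/-- Up to time `t`, the path never moves along a bad edge. -/
def AvoidsBad {E : Type*} [DecidableEq E] {T : ℕ} (σ : ℕ → E) (Bad : E → (E → Bool) → Prop)
    (ω : Fin (T + 1) × E → Bool) (t : ℕ) : Prop :=
  ∀ j < t, Bad (σ j) (pathState σ ω j) → pathState σ ω (j + 1) = pathState σ ω j

section PathDefs

variable {E : Type*} [DecidableEq E] {T : ℕ} {σ : ℕ → E}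

lemma lastTime_le (t : ℕ) (e : E) : lastTime σ t e ≤ t := by
  induction t with
  | zero => simp [lastTime]
  | succ t ih =>
    rw [lastTime]
    by_cases h : e = σ t
    · subst h; simp
    · rw [Function.update_of_ne h]; omega

/-- The resampling with index `j` stamps the coordinate with `j + 1 > t₀`, and later stamps only
increase. -/
lemma lt_lastTime {t₀ j t : ℕ} (h₀ : t₀ ≤ j) (h : j < t) : t₀ < lastTime σ t (σ j) := by
  induction t with
  | zero => omega
  | succ t ih =>
    rw [lastTime]
    by_cases hj : σ j = σ t
    · rw [hj]; simp; omega
    · rw [Function.update_of_ne hj]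
      refine ih (lt_of_le_of_ne (by omega) ?_)
      rintro rfl
      exact hj rfl

lemma pathCoord_injective (t : ℕ) : Function.Injective (pathCoord T σ t) := fun a b h => by
  simpa [pathCoord] using congrArg Prod.snd h

lemma pathState_succ (ω : Fin (T + 1) × E → Bool) (t : ℕ) :
    pathState σ ω (t + 1) =
      Function.update (pathState σ ω t) (σ t) (ω (Fin.ofNat (T + 1) (t + 1), σ t)) := by
  ext e
  by_cases h : e = σ t
  · subst h; simp [pathState, pathCoord, lastTime]
  · simp [pathState, pathCoord, lastTime, Function.update_of_ne h]

/-- The bit stamped `t + 1` is not read before time `t + 1`. The bound `t < T` prevents `Fin.ofNat`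
from wrapping around. -/
lemma pathState_update (ω : Fin (T + 1) × E → Bool) {j t : ℕ} (hj : j ≤ t) (ht : t < T) (b : Bool) :
    pathState σ (Function.update ω (Fin.ofNat (T + 1) (t + 1), σ t) b) j = pathState σ ω j := by
  ext e
  rw [pathState, Function.update_of_ne]
  · rfl
  · intro h
    have h1 : (Fin.ofNat (T + 1) (lastTime σ j e)).val = (Fin.ofNat (T + 1) (t + 1)).val :=
      congrArg Fin.val (congrArg Prod.fst h)
    have h2 := lastTime_le (σ := σ) j e
    simp only [Fin.val_ofNat] at h1
    rw [Nat.mod_eq_of_lt (by omega), Nat.mod_eq_of_lt (by omega)] at h1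
    omega

lemma avoidsBad_succ_iff (Bad : E → (E → Bool) → Prop) (ω : Fin (T + 1) × E → Bool) (t : ℕ) :
    AvoidsBad σ Bad ω (t + 1) ↔ AvoidsBad σ Bad ω t ∧
      (Bad (σ t) (pathState σ ω t) → pathState σ ω (t + 1) = pathState σ ω t) := by
  constructor
  · exact fun h => ⟨fun j hj => h j (by omega), h t (by omega)⟩
  · rintro ⟨h, h'⟩ j hj
    rcases Nat.lt_succ_iff_lt_or_eq.1 hj with hj | rfl
    · exact h j hj
    · exact h'

lemma avoidsBad_update (Bad : E → (E → Bool) → Prop) (ω : Fin (T + 1) × E → Bool) {t : ℕ}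
    (ht : t < T) (b : Bool) :
    AvoidsBad σ Bad (Function.update ω (Fin.ofNat (T + 1) (t + 1), σ t) b) t ↔
      AvoidsBad σ Bad ω t := by
  refine forall_congr' fun j => forall_congr' fun hj => ?_
  rw [pathState_update ω (by omega) ht, pathState_update ω (by omega) ht]

end PathDefs

section Path

variable {E : Type*} [Fintype E] [DecidableEq E] {T : ℕ} {σ : ℕ → E} {p : ℝ}

/-- Stationarity: at a fixed time distinct coordinates read distinct independent bits. -/
lemma cubeE_pathState (t : ℕ) (F : (E → Bool) → ℝ) :
    cubeE p (fun ω : Fin (T + 1) × E → Bool => F (pathState σ ω t)) = cubeE p F :=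
  cubeE_comp_injective (pathCoord_injective t) F

lemma cubePr_pathState (t : ℕ) (Q : (E → Bool) → Prop) :
    cubePr p (fun ω : Fin (T + 1) × E → Bool => Q (pathState σ ω t)) = cubePr p Q := by
  classical
  exact cubeE_pathState t fun x => if Q x then 1 else 0

lemma exp_cubeE_log_le (h0 : 0 ≤ p) (h1 : p ≤ 1) {g : (E → Bool) → ℝ} (hg : ∀ x, 0 < g x) :
    Real.exp (cubeE p fun x => Real.log (g x)) ≤ cubeE p g := by
  have h := convexOn_exp.map_sum_le (t := Finset.univ) (w := cubeWeight p)
    (p := fun x : E → Bool => Real.log (g x)) (fun x _ => cubeWeight_nonneg h0 h1 x)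
    (by simpa [cubeE] using cubeE_const (ι := E) (p := p) 1) (fun _ _ => Set.mem_univ _)
  simpa [cubeE, Real.exp_log (hg _)] using h

/-- One step of the path lower bound: the expected logarithm drops by at most the entropy of one
bit times the probability of a bad edge. -/
lemma cubeE_log_step (h0 : 0 < p) (h1 : p < 1) (e : E) (Bad : (E → Bool) → Prop) [DecidablePred Bad]
    (hBad : ∀ x b, Bad (Function.update x e b) ↔ Bad x) {g : (E → Bool) → ℝ} (hg : ∀ x, 0 < g x)
    {g' : (E → Bool) → ℝ}
    (hg' : ∀ x, Bad x → (if x e = true then p else 1 - p) * g x ≤ g' x)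
    (hg'' : ∀ x, ¬ Bad x →
      p * g (Function.update x e true) + (1 - p) * g (Function.update x e false) ≤ g' x) :
    cubeE p (fun x => Real.log (g x)) -
        -(p * Real.log p + (1 - p) * Real.log (1 - p)) * cubePr p Bad ≤
      cubeE p fun x => Real.log (g' x) := by
  have h1' : 0 < 1 - p := by linarith
  -- Pointwise lower bound for `log g'`. At a bad point only the move that keeps the current bit is
  -- counted, at the price of the logarithm of that bit's probability; elsewhere concavity of `log`
  -- is used.
  set h : (E → Bool) → ℝ := fun x =>
    if Bad x then Real.log (if x e = true then p else 1 - p) + Real.log (g x)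
    else p * Real.log (g (Function.update x e true)) +
      (1 - p) * Real.log (g (Function.update x e false)) with hh
  have hle : cubeE p h ≤ cubeE p fun x => Real.log (g' x) := by
    refine cubeE_mono h0.le h1.le fun x => ?_
    simp only [hh]
    split_ifs with hb hx
    · rw [← Real.log_mul h0.ne' (hg x).ne']
      refine Real.log_le_log (mul_pos h0 (hg x)) ?_
      simpa [hx] using hg' x hb
    · rw [← Real.log_mul h1'.ne' (hg x).ne']
      refine Real.log_le_log (mul_pos h1' (hg x)) ?_
      simpa [hx] using hg' x hb
    · have hc := strictConcaveOn_log_Ioi.concaveOn.2 (Set.mem_Ioi.2 (hg (Function.update x e true)))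
        (Set.mem_Ioi.2 (hg (Function.update x e false))) h0.le h1'.le (by ring)
      simp only [smul_eq_mul] at hc
      refine hc.trans (Real.log_le_log ?_ (hg'' x hb))
      exact add_pos (mul_pos h0 (hg _)) (mul_pos h1' (hg _))
  refine le_trans (le_of_eq ?_) hle
  -- Since `Bad` ignores coordinate `e`, averaging over that coordinate turns the price into `p log
  -- p + (1 - p) log (1 - p)`.
  rw [cubeE_resample e h, cubeE_resample e (fun x => Real.log (g x)), cubePr, ← cubeE_mul_left,
    ← cubeE_sub]
  congr 1
  ext x
  simp only [hh, hBad]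
  by_cases hb : Bad x <;> simp [hb] <;> ring

-- A general positive terminal function `g` makes the induction work: the last step is absorbed by
-- replacing `g` with its one-step conditional expectation `g'`, and the entropy costs add up inside
-- the exponential. Bounding each bad step by its worst case probability `p` instead of the entropy
-- would be too weak.
open Classical in
lemma exp_le_cubeE_avoidsBad (h0 : 0 < p) (h1 : p < 1) (Bad : E → (E → Bool) → Prop)
    (hBad : ∀ e x b, Bad e (Function.update x e b) ↔ Bad e x) (t : ℕ) (ht : t ≤ T)
    (g : (E → Bool) → ℝ) (hg : ∀ x, 0 < g x) :
    Real.exp (cubeE p (fun x => Real.log (g x)) -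
        -(p * Real.log p + (1 - p) * Real.log (1 - p)) *
          ∑ j ∈ Finset.range t, cubePr p (Bad (σ j))) ≤
      cubeE p fun ω : Fin (T + 1) × E → Bool =>
        if AvoidsBad σ Bad ω t then g (pathState σ ω t) else 0 := by
  induction t generalizing g with
  | zero =>
    have h := exp_cubeE_log_le h0.le h1.le hg
    simpa [AvoidsBad, cubeE_pathState] using h
  | succ t ih =>
    have h1' : 0 < 1 - p := by linarith
    set e := σ t with he
    set ok : (E → Bool) → (E → Bool) → Prop := fun x y => Bad e x → y = x with hok
    set g' : (E → Bool) → ℝ := fun x =>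
      p * (if ok x (Function.update x e true) then g (Function.update x e true) else 0) +
      (1 - p) * (if ok x (Function.update x e false) then g (Function.update x e false) else 0)
      with hg'
    have hnn : ∀ (x y : E → Bool), 0 ≤ if ok x y then g y else 0 := fun x y => by
      split_ifs
      · exact (hg y).le
      · exact le_rfl
    have hbad : ∀ x, Bad e x → (if x e = true then p else 1 - p) * g x ≤ g' x := by
      intro x _
      have hself : ok x x := fun _ => rfl
      cases hx : x e
      · have hu : Function.update x e false = x := by rw [← hx]; simp
        have := mul_nonneg h0.le (hnn x (Function.update x e true))
        simp only [hg', hu, hself, if_true]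
        simpa using this
      · have hu : Function.update x e true = x := by rw [← hx]; simp
        have := mul_nonneg h1'.le (hnn x (Function.update x e false))
        simp only [hg', hu, hself, if_true]
        simpa using this
    have hgood : ∀ x, ¬ Bad e x →
        p * g (Function.update x e true) + (1 - p) * g (Function.update x e false) ≤ g' x := by
      intro x hx
      simp [hg', hok, hx]
    have hpos : ∀ x, 0 < g' x := by
      intro x
      by_cases hx : Bad e x
      · refine lt_of_lt_of_le (mul_pos ?_ (hg x)) (hbad x hx)
        split_ifs <;> assumption
      · exact lt_of_lt_of_le (add_pos (mul_pos h0 (hg _)) (mul_pos h1' (hg _))) (hgood x hx)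
    have hstep := cubeE_log_step h0 h1 e (Bad e) (hBad e) hg hbad hgood
    have hih := ih (by omega) g' hpos
    refine le_trans (Real.exp_le_exp.2 ?_) (hih.trans (le_of_eq ?_))
    · rw [Finset.sum_range_succ, mul_add]
      linarith
    -- Averaging over the last bit alone, on which the past does not depend, produces exactly `g'`
    -- at time `t`.
    · rw [cubeE_resample (Fin.ofNat (T + 1) (t + 1), σ t)
        (fun ω : Fin (T + 1) × E → Bool =>
          if AvoidsBad σ Bad ω (t + 1) then g (pathState σ ω (t + 1)) else 0)]
      congr 1
      ext ω
      simp only [avoidsBad_succ_iff, pathState_succ, avoidsBad_update _ _ (show t < T by omega),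
        pathState_update ω le_rfl (show t < T by omega), Function.update_self]
      by_cases hA : AvoidsBad σ Bad ω t
      · simp [hA, hg', hok, he]
      · simp [hA]

/-- The probability that the path avoids all moves along bad edges is at least the exponential of
minus the entropy of a bit times the expected number of bad edges met by a stationary path. -/
lemma exp_le_cubePr_avoidsBad (h0 : 0 < p) (h1 : p < 1) (Bad : E → (E → Bool) → Prop)
    (hBad : ∀ e x b, Bad e (Function.update x e b) ↔ Bad e x) :
    Real.exp ((p * Real.log p + (1 - p) * Real.log (1 - p)) *
          ∑ j ∈ Finset.range T, cubePr p (Bad (σ j))) ≤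
      cubePr p fun ω : Fin (T + 1) × E → Bool => AvoidsBad σ Bad ω T := by
  have h := exp_le_cubeE_avoidsBad (σ := σ) h0 h1 Bad hBad T le_rfl (fun _ => 1)
    (fun _ => one_pos)
  refine le_trans (le_of_eq ?_) h
  congr 1
  simp only [Real.log_one, cubeE_const]
  ring

/-- Cyclic enumeration of a finite type. -/
noncomputable def sweep (E : Type*) [Fintype E] [Nonempty E] (t : ℕ) : E :=
  (Fintype.equivFin E).symm ⟨t % Fintype.card E, Nat.mod_lt _ Fintype.card_pos⟩

lemma exists_sweep_eq {E : Type*} [Fintype E] [Nonempty E] (t₀ : ℕ) (e : E) :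
    ∃ j, t₀ ≤ j ∧ j < t₀ + Fintype.card E ∧ sweep E j = e := by
  set m := Fintype.card E with hm
  have hm0 : 0 < m := Fintype.card_pos
  set r := (Fintype.equivFin E e).val with hr
  have hrm : r < m := (Fintype.equivFin E e).isLt
  obtain ⟨j, h1, h2, h3⟩ : ∃ j, t₀ ≤ j ∧ j < t₀ + m ∧ j % m = r := by
    have hd := Nat.div_add_mod t₀ m
    have hlt := Nat.mod_lt t₀ hm0
    by_cases hc : t₀ % m ≤ r
    · refine ⟨m * (t₀ / m) + r, by omega, by omega, ?_⟩
      rw [Nat.mul_add_mod, Nat.mod_eq_of_lt hrm]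
    · refine ⟨m * (t₀ / m + 1) + r, by rw [mul_add]; omega, by rw [mul_add]; omega, ?_⟩
      rw [Nat.mul_add_mod, Nat.mod_eq_of_lt hrm]
  refine ⟨j, h1, h2, ?_⟩
  rw [sweep, Equiv.symm_apply_eq]
  exact Fin.ext h3

lemma sum_range_sweep {E : Type*} [Fintype E] [Nonempty E] (g : E → ℝ) (K : ℕ) :
    ∑ j ∈ Finset.range (K * Fintype.card E), g (sweep E j) = K * ∑ e, g e := by
  induction K with
  | zero => simp
  | succ K ih =>
    rw [Nat.succ_mul, Finset.sum_range_add, ih, Finset.sum_range]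
    have : ∑ i : Fin (Fintype.card E), g (sweep E (K * Fintype.card E + i)) = ∑ e, g e := by
      refine Fintype.sum_equiv (Fintype.equivFin E).symm _ _ fun i => ?_
      congr 1
      rw [sweep]
      congr 1
      refine Fin.ext ?_
      simp only
      rw [mul_comm, Nat.mul_add_mod, Nat.mod_eq_of_lt i.isLt]
    rw [this]
    push_cast
    ring

end Path

/-! ### Chains of overlapping balanced independent sets along the path -/

/-- There are no edges between `L` and `R` in the graph at time `t`. -/
def EmptyAt {n T : ℕ} (σ : ℕ → BipEdge n) (ω : Fin (T + 1) × BipEdge n → Bool) (t : ℕ)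
    (L R : Finset (Fin n)) : Prop :=
  ∀ i ∈ L, ∀ j ∈ R, pathState σ ω t (i, j) = false

/-- The pair `(L, R)` has `s` vertices on both sides, between `q` and `4 q` of them outside
`(WL, WR)`, with at most `2 q` of the new ones on each side. -/
def OverlapsIn {n : ℕ} (s q : ℕ) (WL WR L R : Finset (Fin n)) : Prop :=
  L.card = s ∧ R.card = s ∧ (L \ WL).card ≤ 2 * q ∧ (R \ WR).card ≤ 2 * q ∧
    q ≤ (L \ WL).card + (R \ WR).card

/-- Starting at time `t₀` from the vertex sets `(WL, WR)` there are `k` successive independent sets,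
each overlapping appropriately with the union of the previous ones, followed by an event `End`. -/
def Chain {n T : ℕ} (σ : ℕ → BipEdge n) (s q : ℕ)
    (End : ℕ → Finset (Fin n) → Finset (Fin n) → (Fin (T + 1) × BipEdge n → Bool) → Prop) :
    ℕ → ℕ → Finset (Fin n) → Finset (Fin n) → (Fin (T + 1) × BipEdge n → Bool) → Prop
  | 0, t₀, WL, WR, ω => End t₀ WL WR ω
  | k + 1, t₀, WL, WR, ω => ∃ t, t₀ ≤ t ∧ t ≤ T ∧ ∃ L R : Finset (Fin n),
      OverlapsIn s q WL WR L R ∧ EmptyAt σ ω t L R ∧ Chain σ s q End k t (WL ∪ L) (WR ∪ R) ω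

/-- At least `m` steps after `t₀`, some `r` by `r` rectangle inside `WL × WR` is empty. -/
def LateEmpty {n T : ℕ} (σ : ℕ → BipEdge n) (m r : ℕ) (t₀ : ℕ) (WL WR : Finset (Fin n))
    (ω : Fin (T + 1) × BipEdge n → Bool) : Prop :=
  ∃ t, t₀ + m ≤ t ∧ t ≤ T ∧ ∃ L R : Finset (Fin n), L ⊆ WL ∧ R ⊆ WR ∧ L.card = r ∧ R.card = r ∧
    EmptyAt σ ω t L R

/-- The independent bits read by the pairs in `L × R` at time `t`. -/
def pairCoords {n : ℕ} (T : ℕ) (σ : ℕ → BipEdge n) (t : ℕ) (L R : Finset (Fin n)) :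
    Finset (Fin (T + 1) × BipEdge n) :=
  (L ×ˢ R).image (pathCoord T σ t)

/-- All bits in `U` belong to times `≤ t₀` and to pairs in `WL × WR`. -/
def SupportedIn {n T : ℕ} (U : Finset (Fin (T + 1) × BipEdge n)) (t₀ : ℕ)
    (WL WR : Finset (Fin n)) : Prop :=
  ∀ u ∈ U, u.1.val ≤ t₀ ∧ u.2.1 ∈ WL ∧ u.2.2 ∈ WR

section ChainBound

variable {n T : ℕ} {σ : ℕ → BipEdge n} {p : ℝ}

lemma emptyAt_iff (ω : Fin (T + 1) × BipEdge n → Bool) (t : ℕ) (L R : Finset (Fin n)) :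
    EmptyAt σ ω t L R ↔ ∀ u ∈ pairCoords T σ t L R, ω u = false := by
  simp only [EmptyAt, pairCoords, Finset.mem_image, Finset.mem_product, pathState]
  constructor
  · rintro h u ⟨⟨i, j⟩, ⟨hi, hj⟩, rfl⟩
    exact h i hi j hj
  · exact fun h i hi j hj => h _ ⟨(i, j), ⟨hi, hj⟩, rfl⟩

lemma SupportedIn.union_pairCoords {U : Finset (Fin (T + 1) × BipEdge n)} {t₀ t : ℕ}
    {WL WR : Finset (Fin n)} (hU : SupportedIn U t₀ WL WR) (ht : t₀ ≤ t) (L R : Finset (Fin n)) :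
    SupportedIn (U ∪ pairCoords T σ t L R) t (WL ∪ L) (WR ∪ R) := by
  intro u hu
  rcases Finset.mem_union.1 hu with hu | hu
  · obtain ⟨h1, h2, h3⟩ := hU u hu
    exact ⟨h1.trans ht, Finset.mem_union_left _ h2, Finset.mem_union_left _ h3⟩
  · obtain ⟨⟨i, j⟩, hij, rfl⟩ := Finset.mem_image.1 hu
    obtain ⟨hi, hj⟩ := Finset.mem_product.1 hij
    refine ⟨?_, Finset.mem_union_right _ hi, Finset.mem_union_right _ hj⟩
    simp only [pathCoord, Fin.val_ofNat]
    exact (Nat.mod_le _ _).trans (lastTime_le _ _)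

/-- Bits of pairs outside `WL ×ˢ WR` cannot lie in `U`, whatever the times. Pairs inside may have
been read already and are not counted. -/
lemma card_union_pairCoords {U : Finset (Fin (T + 1) × BipEdge n)} {t₀ t : ℕ}
    {WL WR : Finset (Fin n)} (hU : SupportedIn U t₀ WL WR) (L R : Finset (Fin n)) :
    U.card + (L.card * R.card - (L.card - (L \ WL).card) * (R.card - (R \ WR).card)) ≤
      (U ∪ pairCoords T σ t L R).card := by
  have h1 : ((L ×ˢ R) \ (WL ×ˢ WR)).card =
      L.card * R.card - (L.card - (L \ WL).card) * (R.card - (R \ WR).card) := by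
    have ha : L.card - (L \ WL).card = (L ∩ WL).card := by
      have := Finset.card_sdiff_add_card_inter L WL
      omega
    have hb : R.card - (R \ WR).card = (R ∩ WR).card := by
      have := Finset.card_sdiff_add_card_inter R WR
      omega
    have := Finset.card_sdiff_add_card_inter (L ×ˢ R) (WL ×ˢ WR)
    rw [Finset.product_inter_product, Finset.card_product, Finset.card_product] at this
    rw [ha, hb]
    omega
  rw [← h1, ← Finset.card_image_of_injective _ (pathCoord_injective (T := T) (σ := σ) t),
    ← Finset.card_union_of_disjoint]
  · refine Finset.card_le_card (Finset.union_subset_union le_rfl ?_)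
    exact Finset.image_subset_image Finset.sdiff_subset
  · rw [Finset.disjoint_right]
    intro u hu hu'
    obtain ⟨⟨i, j⟩, hij, rfl⟩ := Finset.mem_image.1 hu
    obtain ⟨-, h2, h3⟩ := hU _ hu'
    exact (Finset.mem_sdiff.1 hij).2 (Finset.mem_product.2 ⟨h2, h3⟩)

/-- After a full sweep every pair carries a stamp later than `t₀`, so all bits are new, including
those of pairs inside `WL ×ˢ WR`. -/
lemma card_union_pairCoords_of_late {m : ℕ}
    (hσ : ∀ t₀ e, ∃ j, t₀ ≤ j ∧ j < t₀ + m ∧ σ j = e)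
    {U : Finset (Fin (T + 1) × BipEdge n)} {t₀ t : ℕ}
    {WL WR : Finset (Fin n)} (hU : SupportedIn U t₀ WL WR) (ht : t₀ + m ≤ t) (htT : t ≤ T)
    (L R : Finset (Fin n)) :
    (U ∪ pairCoords T σ t L R).card = U.card + L.card * R.card := by
  rw [Finset.card_union_of_disjoint, pairCoords,
    Finset.card_image_of_injective _ (pathCoord_injective t), Finset.card_product]
  rw [Finset.disjoint_right]
  intro u hu hu'
  obtain ⟨e, -, rfl⟩ := Finset.mem_image.1 hu
  have h1 := (hU _ hu').1
  obtain ⟨j, hj1, hj2, rfl⟩ := hσ t₀ e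
  have h2 : t₀ < lastTime σ t (σ j) := lt_lastTime hj1 (by omega)
  have h3 := lastTime_le (σ := σ) t (σ j)
  simp only [pathCoord, Fin.val_ofNat] at h1
  rw [Nat.mod_eq_of_lt (by omega)] at h1
  omega

lemma forall_union_pairCoords_iff (U : Finset (Fin (T + 1) × BipEdge n)) (t : ℕ)
    (L R : Finset (Fin n)) (ω : Fin (T + 1) × BipEdge n → Bool) :
    (∀ u ∈ U ∪ pairCoords T σ t L R, ω u = false) ↔
      (∀ u ∈ U, ω u = false) ∧ EmptyAt σ ω t L R := by
  rw [emptyAt_iff, Finset.forall_mem_union]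

-- Induction on the number of recorded sets, with `U` collecting the bits already forced to vanish.
-- Each stage is a union bound over the time and the new pair of sets, weighted by the number of
-- newly read bits. The cap `M` on the accumulated vertex sets allows a single `β` for all stages.
open Classical in
lemma cubePr_chain_le (h0 : 0 ≤ p) (h1 : p ≤ 1) {s q M : ℕ}
    {End : ℕ → Finset (Fin n) → Finset (Fin n) → (Fin (T + 1) × BipEdge n → Bool) → Prop}
    {β B : ℝ} (hβ : 0 ≤ β) (hB : 0 ≤ B)
    (hstep : ∀ WL WR : Finset (Fin n), WL.card ≤ M → WR.card ≤ M →
      ((T : ℝ) + 1) * ∑ A ∈ Finset.univ.filter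
        (fun A : Finset (Fin n) × Finset (Fin n) => OverlapsIn s q WL WR A.1 A.2),
        (1 - p) ^ (s * s - (s - (A.1 \ WL).card) * (s - (A.2 \ WR).card)) ≤ β)
    (hEnd : ∀ t₀ (WL WR : Finset (Fin n)) (U : Finset (Fin (T + 1) × BipEdge n)),
      WL.card ≤ M → WR.card ≤ M → SupportedIn U t₀ WL WR →
      cubePr p (fun ω => (∀ u ∈ U, ω u = false) ∧ End t₀ WL WR ω) ≤ (1 - p) ^ U.card * B)
    (k : ℕ) (t₀ : ℕ) (WL WR : Finset (Fin n)) (U : Finset (Fin (T + 1) × BipEdge n))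
    (hWL : WL.card + k * s ≤ M) (hWR : WR.card + k * s ≤ M) (hU : SupportedIn U t₀ WL WR) :
    cubePr p (fun ω => (∀ u ∈ U, ω u = false) ∧ Chain σ s q End k t₀ WL WR ω) ≤
      (1 - p) ^ U.card * (β ^ k * B) := by
  induction k generalizing t₀ WL WR U with
  | zero => simpa [Chain] using hEnd t₀ WL WR U (by omega) (by omega) hU
  | succ k ih =>
    have h1' : 0 ≤ 1 - p := by linarith
    set 𝒜 := Finset.univ.filter
        (fun A : Finset (Fin n) × Finset (Fin n) => OverlapsIn s q WL WR A.1 A.2) with h𝒜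
    set I := (Finset.range (T + 1)).filter (fun t => t₀ ≤ t) with hI
    have hle : ∀ ω : Fin (T + 1) × BipEdge n → Bool,
        ((∀ u ∈ U, ω u = false) ∧ Chain σ s q End (k + 1) t₀ WL WR ω) →
        ∃ a ∈ I ×ˢ 𝒜, (∀ u ∈ U ∪ pairCoords T σ a.1 a.2.1 a.2.2, ω u = false) ∧
          Chain σ s q End k a.1 (WL ∪ a.2.1) (WR ∪ a.2.2) ω := by
      rintro ω ⟨hω, t, ht0, htT, L, R, hov, hemp, hch⟩
      refine ⟨(t, L, R), ?_, (forall_union_pairCoords_iff U t L R ω).2 ⟨hω, hemp⟩, hch⟩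
      simp [hI, h𝒜, ht0, hov]
      omega
    refine (cubePr_mono h0 h1 hle).trans ((cubePr_exists_le h0 h1 _ _).trans ?_)
    have hterm : ∀ a ∈ I ×ˢ 𝒜,
        cubePr p (fun ω => (∀ u ∈ U ∪ pairCoords T σ a.1 a.2.1 a.2.2, ω u = false) ∧
          Chain σ s q End k a.1 (WL ∪ a.2.1) (WR ∪ a.2.2) ω) ≤
        (1 - p) ^ (s * s - (s - (a.2.1 \ WL).card) * (s - (a.2.2 \ WR).card)) *
          ((1 - p) ^ U.card * (β ^ k * B)) := by
      rintro ⟨t, L, R⟩ ha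
      simp only [hI, h𝒜, Finset.mem_product, Finset.mem_filter, Finset.mem_univ, true_and,
        Finset.mem_range] at ha
      obtain ⟨⟨htT, ht0⟩, hov⟩ := ha
      have hLc := Finset.card_union_le WL L
      have hRc := Finset.card_union_le WR R
      obtain ⟨hL, hR, -⟩ := hov
      have hks : (k + 1) * s = k * s + s := by ring
      refine (ih t (WL ∪ L) (WR ∪ R) _ (by omega) (by omega)
        (hU.union_pairCoords ht0 L R)).trans ?_
      have hcard := card_union_pairCoords (σ := σ) (t := t) hU L R
      rw [hL, hR] at hcard
      rw [← mul_assoc ((1 - p) ^ (s * s - _)), ← pow_add]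
      refine mul_le_mul_of_nonneg_right ?_ (mul_nonneg (pow_nonneg hβ _) hB)
      refine pow_le_pow_of_le_one h1' (by linarith) ?_
      simp only
      omega
    refine (Finset.sum_le_sum hterm).trans ?_
    rw [Finset.sum_product]
    simp only [Finset.sum_const, nsmul_eq_mul, ← Finset.sum_mul]
    have hIcard : (I.card : ℝ) ≤ T + 1 := by
      have : I.card ≤ T + 1 := (Finset.card_filter_le _ _).trans (by simp)
      exact_mod_cast this
    have hks : (k + 1) * s = k * s + s := by ring
    have hst := hstep WL WR (by omega) (by omega)
    have hsum : 0 ≤ ∑ A ∈ 𝒜,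
        (1 - p) ^ (s * s - (s - (A.1 \ WL).card) * (s - (A.2 \ WR).card)) :=
      Finset.sum_nonneg fun _ _ => pow_nonneg h1' _
    have hC : 0 ≤ (1 - p) ^ U.card * (β ^ k * B) := by positivity
    calc _ = (I.card * ∑ A ∈ 𝒜,
          (1 - p) ^ (s * s - (s - (A.1 \ WL).card) * (s - (A.2 \ WR).card))) *
          ((1 - p) ^ U.card * (β ^ k * B)) := by ring
      _ ≤ β * ((1 - p) ^ U.card * (β ^ k * B)) := by
          refine mul_le_mul_of_nonneg_right (le_trans ?_ hst) hC
          exact mul_le_mul_of_nonneg_right hIcard hsum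
      _ = _ := by ring

/-- The sum factors over vertices, with factor `2` on `W` and `1 + z` off `W`. -/
lemma sum_pow_card_sdiff_le {z : ℝ} (hz : 0 ≤ z) (W : Finset (Fin n)) :
    ∑ L : Finset (Fin n), z ^ (L \ W).card ≤ 2 ^ W.card * (1 + z) ^ n := by
  have h1 : ∑ L : Finset (Fin n), z ^ (L \ W).card =
      ∏ i : Fin n, (1 + if i ∈ W then 1 else z) := by
    rw [Finset.prod_one_add, Finset.powerset_univ]
    refine Finset.sum_congr rfl fun L _ => ?_
    rw [Finset.prod_ite, Finset.prod_const_one, one_mul, Finset.prod_const, Finset.sdiff_eq_filter]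
  have h2 : (2 : ℝ) ^ W.card * (1 + z) ^ n =
      ∏ i : Fin n, ((if i ∈ W then 2 else 1) * (1 + z)) := by
    rw [Finset.prod_mul_distrib, Finset.prod_ite_mem, Finset.univ_inter, Finset.prod_const,
      Finset.prod_const, Finset.card_univ, Fintype.card_fin]
  rw [h1, h2]
  refine Finset.prod_le_prod (fun i _ => ?_) fun i _ => ?_
  · split_ifs <;> linarith
  · split_ifs <;> linarith

-- Every new vertex contributes a factor of at most `(1 - p) ^ (s - q) ≤ z * w`. The part `z` makes
-- the sum over all sets affordable, and `w` is the net gain, collected at least `q` times.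
open Classical in
lemma sum_overlapsIn_le (h0 : 0 ≤ p) (h1 : p ≤ 1) {s q M : ℕ} (hqs : q ≤ s) {z w : ℝ} (hz : 0 ≤ z)
    (hw0 : 0 ≤ w) (hw1 : w ≤ 1) (hzw : (1 - p) ^ (s - q) ≤ z * w) {WL WR : Finset (Fin n)}
    (hWL : WL.card ≤ M) (hWR : WR.card ≤ M) :
    ∑ A ∈ Finset.univ.filter
        (fun A : Finset (Fin n) × Finset (Fin n) => OverlapsIn s q WL WR A.1 A.2),
        (1 - p) ^ (s * s - (s - (A.1 \ WL).card) * (s - (A.2 \ WR).card)) ≤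
      w ^ q * (2 ^ M * (1 + z) ^ n) ^ 2 := by
  have h1' : 0 ≤ 1 - p := by linarith
  have hS : ∀ W : Finset (Fin n), W.card ≤ M →
      ∑ L : Finset (Fin n), z ^ (L \ W).card ≤ 2 ^ M * (1 + z) ^ n := by
    intro W hW
    refine (sum_pow_card_sdiff_le hz W).trans (mul_le_mul_of_nonneg_right ?_ (by positivity))
    exact pow_le_pow_right₀ (by norm_num) hW
  have hS0 : ∀ W : Finset (Fin n), 0 ≤ ∑ L : Finset (Fin n), z ^ (L \ W).card := fun W =>
    Finset.sum_nonneg fun _ _ => pow_nonneg hz _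
  calc _ ≤ ∑ A ∈ Finset.univ.filter
        (fun A : Finset (Fin n) × Finset (Fin n) => OverlapsIn s q WL WR A.1 A.2),
        w ^ q * (z ^ (A.1 \ WL).card * z ^ (A.2 \ WR).card) := by
        refine Finset.sum_le_sum fun A hA => ?_
        obtain ⟨hL, hR, hx, hy, hxy⟩ := (Finset.mem_filter.1 hA).2
        have hxs : (A.1 \ WL).card ≤ s := hL ▸ Finset.card_le_card Finset.sdiff_subset
        have hys : (A.2 \ WR).card ≤ s := hR ▸ Finset.card_le_card Finset.sdiff_subset
        generalize (A.1 \ WL).card = x at *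
        generalize (A.2 \ WR).card = y at *
        -- With `x, y ≤ 2 q`, one has `x y ≤ (x + y) ^ 2 / 4 ≤ q (x + y)`.
        have hexp : (s - q) * (x + y) ≤ s * s - (s - x) * (s - y) := by
          have hle : (s - x) * (s - y) ≤ s * s := Nat.mul_le_mul (by omega) (by omega)
          zify [hqs, hle, hxs, hys] at *
          nlinarith
        calc (1 - p) ^ (s * s - (s - x) * (s - y)) ≤ (1 - p) ^ ((s - q) * (x + y)) :=
              pow_le_pow_of_le_one h1' (by linarith) hexp
          _ = ((1 - p) ^ (s - q)) ^ (x + y) := by rw [pow_mul]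
          _ ≤ (z * w) ^ (x + y) := pow_le_pow_left₀ (pow_nonneg h1' _) hzw _
          _ = w ^ (x + y) * (z ^ x * z ^ y) := by rw [mul_pow, pow_add z]; ring
          _ ≤ w ^ q * (z ^ x * z ^ y) :=
              mul_le_mul_of_nonneg_right (pow_le_pow_of_le_one hw0 hw1 hxy) (by positivity)
    _ ≤ ∑ A : Finset (Fin n) × Finset (Fin n),
        w ^ q * (z ^ (A.1 \ WL).card * z ^ (A.2 \ WR).card) :=
        Finset.sum_le_sum_of_subset_of_nonneg (Finset.filter_subset _ _)
          fun _ _ _ => by positivity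
    _ = w ^ q * ((∑ L : Finset (Fin n), z ^ (L \ WL).card) *
          ∑ R : Finset (Fin n), z ^ (R \ WR).card) := by
        rw [← Finset.mul_sum, Fintype.sum_prod_type, Finset.sum_mul_sum]
    _ ≤ _ := by
        refine mul_le_mul_of_nonneg_left ?_ (pow_nonneg hw0 _)
        rw [sq]
        exact mul_le_mul (hS WL hWL) (hS WR hWR) (hS0 WR) (by positivity)

/-- All `r * r` bits are fresh, and as the rectangle lies in `WL × WR` the union bound costs only `2
^ M` per side instead of a count of all vertex subsets. -/
lemma cubePr_lateEmpty_le (h0 : 0 ≤ p) (h1 : p ≤ 1) {m r M : ℕ}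
    (hσ : ∀ t₀ e, ∃ j, t₀ ≤ j ∧ j < t₀ + m ∧ σ j = e)
    (t₀ : ℕ) (WL WR : Finset (Fin n)) (U : Finset (Fin (T + 1) × BipEdge n))
    (hWL : WL.card ≤ M) (hWR : WR.card ≤ M) (hU : SupportedIn U t₀ WL WR) :
    cubePr p (fun ω => (∀ u ∈ U, ω u = false) ∧ LateEmpty σ m r t₀ WL WR ω) ≤
      (1 - p) ^ U.card * ((T + 1) * (2 ^ M) ^ 2 * (1 - p) ^ (r * r)) := by
  have h1' : 0 ≤ 1 - p := by linarith
  set I := (Finset.range (T + 1)).filter (fun t => t₀ + m ≤ t) with hI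
  set 𝒜 := WL.powersetCard r ×ˢ WR.powersetCard r with h𝒜
  have hle : ∀ ω : Fin (T + 1) × BipEdge n → Bool,
      ((∀ u ∈ U, ω u = false) ∧ LateEmpty σ m r t₀ WL WR ω) →
      ∃ a ∈ I ×ˢ 𝒜, ∀ u ∈ U ∪ pairCoords T σ a.1 a.2.1 a.2.2, ω u = false := by
    rintro ω ⟨hω, t, ht0, htT, L, R, hL, hR, hLc, hRc, hemp⟩
    refine ⟨(t, L, R), ?_, (forall_union_pairCoords_iff U t L R ω).2 ⟨hω, hemp⟩⟩
    simp [hI, h𝒜, ht0, hL, hR, hLc, hRc]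
    omega
  refine (cubePr_mono h0 h1 hle).trans ((cubePr_exists_le h0 h1 _ _).trans ?_)
  have hterm : ∀ a ∈ I ×ˢ 𝒜,
      cubePr p (fun ω => ∀ u ∈ U ∪ pairCoords T σ a.1 a.2.1 a.2.2, ω u = false) =
        (1 - p) ^ U.card * (1 - p) ^ (r * r) := by
    rintro ⟨t, L, R⟩ ha
    simp only [hI, h𝒜, Finset.mem_product, Finset.mem_filter, Finset.mem_powersetCard,
      Finset.mem_range] at ha
    obtain ⟨⟨htT, ht0⟩, ⟨-, hLc⟩, -, hRc⟩ := ha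
    rw [cubePr_forall_false, card_union_pairCoords_of_late hσ hU ht0 (by omega), hLc, hRc, pow_add]
  rw [Finset.sum_congr rfl hterm, Finset.sum_const, nsmul_eq_mul, Finset.card_product]
  have hIcard : (I.card : ℝ) ≤ T + 1 := by
    have : I.card ≤ T + 1 := (Finset.card_filter_le _ _).trans (by simp)
    exact_mod_cast this
  have hpc : ∀ W : Finset (Fin n), W.card ≤ M → ((W.powersetCard r).card : ℝ) ≤ 2 ^ M := by
    intro W hW
    have h2 : (W.powersetCard r).card ≤ 2 ^ M := by
      refine (Finset.card_le_card
        fun A hA => Finset.mem_powerset.2 (Finset.mem_powersetCard.1 hA).1).trans ?_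
      rw [Finset.card_powerset]
      exact Nat.pow_le_pow_right (by norm_num) hW
    exact_mod_cast h2
  rw [h𝒜, Finset.card_product]
  push_cast
  calc _ = (1 - p) ^ U.card * ((I.card : ℝ) * (((WL.powersetCard r).card : ℝ) *
        ((WR.powersetCard r).card : ℝ)) * (1 - p) ^ (r * r)) := by ring
    _ ≤ _ := by
      refine mul_le_mul_of_nonneg_left ?_ (pow_nonneg h1' _)
      refine mul_le_mul_of_nonneg_right ?_ (pow_nonneg h1' _)
      refine mul_le_mul hIcard ?_ (by positivity) (by positivity)
      rw [sq]
      exact mul_le_mul (hpc WL hWL) (hpc WR hWR) (by positivity) (by positivity)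

/-- One term of the binomial expansion; with `z = 1 / d` it gives `n.choose s ≤ d ^ s * exp (n /
d)`. -/
lemma choose_mul_pow_le {z : ℝ} (hz : 0 ≤ z) (s : ℕ) : (n.choose s : ℝ) * z ^ s ≤ (1 + z) ^ n := by
  rcases le_or_gt s n with hs | hs
  · rw [add_comm, add_pow]
    have := Finset.single_le_sum (f := fun m => z ^ m * 1 ^ (n - m) * (n.choose m : ℝ))
      (fun i _ => by positivity) (Finset.mem_range.2 (Nat.lt_succ_of_le hs))
    refine le_trans (le_of_eq ?_) this
    simp [mul_comm]
  · rw [Nat.choose_eq_zero_of_lt hs]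
    simp
    positivity

/-- The first-moment bound for chains started by an independent set at time `0`. -/
lemma cubePr_exists_chain_le (h0 : 0 ≤ p) (h1 : p ≤ 1) {s q M : ℕ} (hqs : q ≤ s) {z w : ℝ}
    (hz : 0 ≤ z) (hw0 : 0 ≤ w) (hw1 : w ≤ 1) (hzw : (1 - p) ^ (s - q) ≤ z * w)
    {End : ℕ → Finset (Fin n) → Finset (Fin n) → (Fin (T + 1) × BipEdge n → Bool) → Prop}
    {B : ℝ} (hB : 0 ≤ B)
    (hEnd : ∀ t₀ (WL WR : Finset (Fin n)) (U : Finset (Fin (T + 1) × BipEdge n)),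
      WL.card ≤ M → WR.card ≤ M → SupportedIn U t₀ WL WR →
      cubePr p (fun ω => (∀ u ∈ U, ω u = false) ∧ End t₀ WL WR ω) ≤ (1 - p) ^ U.card * B)
    (k : ℕ) (hk : (k + 1) * s ≤ M) :
    cubePr p (fun ω => ∃ L R : Finset (Fin n), L.card = s ∧ R.card = s ∧ EmptyAt σ ω 0 L R ∧
        Chain σ s q End k 0 L R ω) ≤
      (n.choose s : ℝ) ^ 2 * (1 - p) ^ (s * s) *
        ((((T : ℝ) + 1) * (w ^ q * (2 ^ M * (1 + z) ^ n) ^ 2)) ^ k * B) := by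
  classical
  have h1' : 0 ≤ 1 - p := by linarith
  set β := ((T : ℝ) + 1) * (w ^ q * (2 ^ M * (1 + z) ^ n) ^ 2) with hβ
  set 𝒬 := (Finset.univ : Finset (Fin n)).powersetCard s with h𝒬
  have hβ0 : 0 ≤ β := by positivity
  have hle : ∀ ω : Fin (T + 1) × BipEdge n → Bool,
      (∃ L R : Finset (Fin n), L.card = s ∧ R.card = s ∧ EmptyAt σ ω 0 L R ∧
        Chain σ s q End k 0 L R ω) →
      ∃ a ∈ 𝒬 ×ˢ 𝒬, (∀ u ∈ pairCoords T σ 0 a.1 a.2, ω u = false) ∧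
        Chain σ s q End k 0 a.1 a.2 ω := by
    rintro ω ⟨L, R, hL, hR, hemp, hch⟩
    exact ⟨(L, R), by simp [h𝒬, hL, hR], (emptyAt_iff _ _ _ _).1 hemp, hch⟩
  refine (cubePr_mono h0 h1 hle).trans ((cubePr_exists_le h0 h1 _ _).trans ?_)
  have hterm : ∀ a ∈ 𝒬 ×ˢ 𝒬,
      cubePr p (fun ω => (∀ u ∈ pairCoords T σ 0 a.1 a.2, ω u = false) ∧
        Chain σ s q End k 0 a.1 a.2 ω) ≤ (1 - p) ^ (s * s) * (β ^ k * B) := by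
    rintro ⟨L, R⟩ ha
    simp only [h𝒬, Finset.mem_product, Finset.mem_powersetCard] at ha
    obtain ⟨⟨-, hL⟩, -, hR⟩ := ha
    have hks : (k + 1) * s = k * s + s := by ring
    have hc : (pairCoords T σ 0 L R).card = s * s := by
      rw [pairCoords, Finset.card_image_of_injective _ (pathCoord_injective 0),
        Finset.card_product, hL, hR]
    rw [← hc]
    refine cubePr_chain_le h0 h1 hβ0 hB ?_ hEnd k 0 L R _ (by omega) (by omega) ?_
    · intro WL WR hWL hWR
      refine mul_le_mul_of_nonneg_left ?_ (by positivity)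
      exact sum_overlapsIn_le h0 h1 hqs hz hw0 hw1 hzw hWL hWR
    · have hE : SupportedIn (∅ : Finset (Fin (T + 1) × BipEdge n)) 0 ∅ ∅ := by
        intro u hu; simp at hu
      simpa using hE.union_pairCoords (σ := σ) le_rfl L R
  refine (Finset.sum_le_sum hterm).trans (le_of_eq ?_)
  rw [Finset.sum_const, nsmul_eq_mul, Finset.card_product, h𝒬, Finset.card_powersetCard]
  simp
  ring

end ChainBound

/-! ### A stable path of balanced independent sets contains a chain -/

section StablePath

variable {n T : ℕ} {σ : ℕ → BipEdge n}

/-- Take as many elements of `V ∩ W` as possible. -/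
lemma exists_subset_card_eq_sdiff_eq {α : Type*} [DecidableEq α] {V W : Finset α} {s : ℕ}
    (hs : s ≤ V.card) :
    ∃ L ⊆ V, L.card = s ∧ (L \ W).card = s - (V ∩ W).card := by
  rcases le_or_gt s (V ∩ W).card with h | h
  · obtain ⟨L, hL, hLs⟩ := Finset.exists_subset_card_eq h
    refine ⟨L, hL.trans Finset.inter_subset_left, hLs, ?_⟩
    rw [Finset.sdiff_eq_empty_iff_subset.2 (hL.trans Finset.inter_subset_right)]
    simp
    omega
  · obtain ⟨L, h1, h2, h3⟩ := Finset.exists_subsuperset_card_eq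
      (Finset.inter_subset_left (s₁ := V) (s₂ := W)) h.le hs
    refine ⟨L, h2, h3, ?_⟩
    have h4 : L ∩ W = V ∩ W := by
      ext a
      simp only [Finset.mem_inter]
      exact ⟨fun h => ⟨h2 h.1, h.2⟩, fun h => ⟨h1 (Finset.mem_inter.2 h), h.2⟩⟩
    have := Finset.card_sdiff_add_card_inter L W
    rw [h4] at this
    omega

/-- If the path carries independent sets with at least `s` vertices on both sides that change by
at most `q` vertices in each step, then it contains a long chain, or an empty rectangle inside the
union of a chain that survives a full sweep. -/
lemma exists_chain_of_stable {m s q : ℕ}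
    (ω : Fin (T + 1) × BipEdge n → Bool) (VL VR : ℕ → Finset (Fin n))
    (hemp : ∀ t ≤ T, EmptyAt σ ω t (VL t) (VR t))
    (hVL : ∀ t ≤ T, s ≤ (VL t).card) (hVR : ∀ t ≤ T, s ≤ (VR t).card)
    (hjL : ∀ t < T, (VL t \ VL (t + 1)).card ≤ q) (hjR : ∀ t < T, (VR t \ VR (t + 1)).card ≤ q)
    (k : ℕ) (t₀ : ℕ) (WL WR : Finset (Fin n)) (ht : t₀ + k * m ≤ T)
    (hL : s ≤ (VL t₀ ∩ WL).card) (hR : s ≤ (VR t₀ ∩ WR).card) :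
    Chain σ s q (fun _ _ _ _ => True) k t₀ WL WR ω ∨
      ∃ j < k, Chain σ s q (LateEmpty σ m (s - q)) j t₀ WL WR ω := by
  induction k generalizing t₀ WL WR with
  | zero => exact Or.inl trivial
  | succ k ih =>
    have hkm : (k + 1) * m = k * m + m := by ring
    by_cases hlate : LateEmpty σ m (s - q) t₀ WL WR ω
    · exact Or.inr ⟨0, Nat.succ_pos k, hlate⟩
    -- If both overlaps were still at least `s - q` after `m` steps, the current independent set
    -- would supply a late empty rectangle.
    have hexm : ∃ i ≤ m, (VL (t₀ + i) ∩ WL).card < s - q ∨ (VR (t₀ + i) ∩ WR).card < s - q := by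
      by_contra hcon
      push Not at hcon
      obtain ⟨h1, h2⟩ := hcon m le_rfl
      obtain ⟨L, hLs, hLc⟩ := Finset.exists_subset_card_eq h1
      obtain ⟨R, hRs, hRc⟩ := Finset.exists_subset_card_eq h2
      refine hlate ⟨t₀ + m, le_rfl, by omega, L, R, hLs.trans Finset.inter_subset_right,
        hRs.trans Finset.inter_subset_right, hLc, hRc, ?_⟩
      exact fun i hi j hj => hemp _ (by omega) i (Finset.inter_subset_left (hLs hi)) j
        (Finset.inter_subset_left (hRs hj))
    classical
    obtain ⟨i₀, hi₀m, hi₀⟩ := hexm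
    have hex : ∃ i, (VL (t₀ + i) ∩ WL).card < s - q ∨ (VR (t₀ + i) ∩ WR).card < s - q := ⟨i₀, hi₀⟩
    set i := Nat.find hex with hi
    have him : i ≤ m := (Nat.find_min' hex hi₀).trans hi₀m
    have hispec := Nat.find_spec hex
    rw [← hi] at hispec
    have hi0 : i ≠ 0 := by
      intro h
      rw [h, add_zero] at hispec
      omega
    obtain ⟨i', hi'⟩ := Nat.exists_eq_succ_of_ne_zero hi0
    have hprev := Nat.find_min hex (m := i') (by omega)
    push Not at hprev
    have hstep : ∀ V W V' : Finset (Fin n), (V ∩ W).card ≤ (V' ∩ W).card + (V \ V').card := by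
      intro V W V'
      refine (Finset.card_le_card ?_).trans (Finset.card_union_le _ _)
      intro a ha
      by_cases h : a ∈ V'
      · exact Finset.mem_union_left _
          (Finset.mem_inter.2 ⟨h, (Finset.mem_inter.1 ha).2⟩)
      · exact Finset.mem_union_right _ (Finset.mem_sdiff.2 ⟨(Finset.mem_inter.1 ha).1, h⟩)
    have hidx : t₀ + i = t₀ + i' + 1 := by omega
    have hL1 := hstep (VL (t₀ + i')) WL (VL (t₀ + i))
    have hR1 := hstep (VR (t₀ + i')) WR (VR (t₀ + i))
    have hL2 := hjL (t₀ + i') (by omega)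
    have hR2 := hjR (t₀ + i') (by omega)
    rw [← hidx] at hL2 hR2
    obtain ⟨L, hLV, hLc, hLd⟩ := exists_subset_card_eq_sdiff_eq (W := WL) (hVL (t₀ + i) (by omega))
    obtain ⟨R, hRV, hRc, hRd⟩ := exists_subset_card_eq_sdiff_eq (W := WR) (hVR (t₀ + i) (by omega))
    -- At the first drop, the preceding overlaps were at least `s - q` and one step loses at most
    -- `q`, so each side has at most `2 q` new vertices; the side that dropped has more than `q`.
    have hov : OverlapsIn s q WL WR L R := by
      refine ⟨hLc, hRc, ?_, ?_, ?_⟩ <;> omega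
    have hempt : EmptyAt σ ω (t₀ + i) L R := fun a ha b hb =>
      hemp _ (by omega) a (hLV ha) b (hRV hb)
    have hnew : ∀ {V W L : Finset (Fin n)}, L ⊆ V → L.card = s → s ≤ (V ∩ (W ∪ L)).card := by
      intro V W L h1 h2
      rw [← h2]
      exact Finset.card_le_card (Finset.subset_inter h1 Finset.subset_union_right)
    rcases ih (t₀ + i) (WL ∪ L) (WR ∪ R) (by omega) (hnew hLV hLc) (hnew hRV hRc) with h | h
    · exact Or.inl ⟨t₀ + i, by omega, by omega, L, R, hov, hempt, h⟩
    · obtain ⟨j, hj, hch⟩ := h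
      exact Or.inr ⟨j + 1, by omega, t₀ + i, by omega, by omega, L, R, hov, hempt, hch⟩

end StablePath

/-! ### Stability of rounding and the obstruction for low-degree maps -/

section Rounding

variable {n : ℕ}

lemma leftCard_eq_card_toLeft (S : Finset (BipVertex n)) : leftCard S = S.toLeft.card := by
  rw [leftCard, ← Finset.card_map (s := S.toLeft) Function.Embedding.inl]
  refine congrArg Finset.card ?_
  ext (i | i) <;> simp

lemma rightCard_eq_card_toRight (S : Finset (BipVertex n)) : rightCard S = S.toRight.card := by
  rw [rightCard, ← Finset.card_map (s := S.toRight) Function.Embedding.inr]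
  refine congrArg Finset.card ?_
  ext (i | i) <;> simp

lemma roundedSet_eq_of_leftCard_pos {η : ℝ} {A : BipEdge n → Bool} {x : BipVertex n → ℝ}
    (h : 0 < leftCard (roundedSet η A x)) :
    (((roundI x \ roundITilde A x).card + (roundJ x).card : ℕ) : ℝ) ≤ η * n ∧
      roundedSet η A x = roundITilde A x := by
  classical
  unfold roundedSet at h ⊢
  split_ifs at h ⊢ with hc
  · exact ⟨hc, rfl⟩
  · simp [leftCard] at h

lemma roundITilde_independent (A : BipEdge n → Bool) (x : BipVertex n → ℝ) {i j : Fin n}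
    (hi : Sum.inl i ∈ roundITilde A x) (hj : Sum.inr j ∈ roundITilde A x) : A (i, j) = false := by
  classical
  simp only [roundITilde, Finset.mem_filter] at hi hj
  have h := hi.2 _ hj.1
  by_contra hA
  exact h (Or.inl ⟨i, j, rfl, rfl, by simpa using hA⟩)

/-- A lost vertex has `x v ≥ 1`. Either `y v ≤ 1 / 2`, which costs at least `1 / 4` in squared
distance, or it lies in the `I \ Ĩ` or `J` part of `y`, which the rounding rule limits to `η n`
vertices. The gap between `1 / 2` and `1` is what gives stability. -/
lemma card_roundITilde_sdiff_le {η : ℝ} {A B : BipEdge n → Bool} {x y : BipVertex n → ℝ}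
    (hy : (((roundI y \ roundITilde B y).card + (roundJ y).card : ℕ) : ℝ) ≤ η * n) :
    ((roundITilde A x \ roundITilde B y).card : ℝ) ≤ 4 * ∑ v, (x v - y v) ^ 2 + η * n := by
  classical
  set S := Finset.univ.filter fun v => 1 ≤ x v ∧ y v ≤ 1 / 2 with hS
  have hsub : roundITilde A x \ roundITilde B y ⊆
      S ∪ ((roundI y \ roundITilde B y) ∪ roundJ y) := by
    intro v hv
    obtain ⟨h1, h2⟩ := Finset.mem_sdiff.1 hv
    have hx : 1 ≤ x v := (Finset.mem_filter.1 (Finset.mem_filter.1 h1).1).2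
    simp only [Finset.mem_union, hS, Finset.mem_filter, Finset.mem_univ, true_and, Finset.mem_sdiff,
      h2, not_false_eq_true, and_true, roundJ, roundI]
    rcases le_or_gt (y v) (1 / 2) with h | h
    · exact Or.inl ⟨hx, h⟩
    · rcases le_or_gt 1 (y v) with h' | h'
      · exact Or.inr (Or.inl h')
      · exact Or.inr (Or.inr ⟨h, h'⟩)
  have hScard : (S.card : ℝ) ≤ 4 * ∑ v, (x v - y v) ^ 2 := by
    have h1 : ∑ v ∈ S, (1 / 4 : ℝ) ≤ ∑ v ∈ S, (x v - y v) ^ 2 := by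
      refine Finset.sum_le_sum fun v hv => ?_
      obtain ⟨h1, h2⟩ := (Finset.mem_filter.1 hv).2
      nlinarith
    have h2 : ∑ v ∈ S, (x v - y v) ^ 2 ≤ ∑ v, (x v - y v) ^ 2 :=
      Finset.sum_le_sum_of_subset_of_nonneg (Finset.subset_univ _) fun _ _ _ => sq_nonneg _
    rw [Finset.sum_const, nsmul_eq_mul] at h1
    linarith
  have hcard := (Finset.card_le_card hsub).trans ((Finset.card_union_le _ _).trans
    (Nat.add_le_add_left (Finset.card_union_le _ _) _))
  have hcard' : ((roundITilde A x \ roundITilde B y).card : ℝ) ≤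
      S.card + ((roundI y \ roundITilde B y).card + (roundJ y).card : ℕ) := by
    exact_mod_cast hcard
  linarith

end Rounding

section Obstruction

variable {n : ℕ}

/-- The rounded output is a set with at least `s` vertices on both sides. -/
def RoundsTo (η : ℝ) (s : ℕ) (f : (BipEdge n → Bool) → BipVertex n → ℝ) (A : BipEdge n → Bool) :
    Prop :=
  s ≤ leftCard (roundedSet η A (f A)) ∧ s ≤ rightCard (roundedSet η A (f A))

/-- Markov in each direction, then the total influence bound summed over output coordinates. The
factor `1 / (p (1 - p))` will cancel against the entropy of a bit. -/
lemma sum_cubePr_large_deriv_le {p : ℝ} (h0 : 0 < p) (h1 : p < 1) {D : ℕ}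
    {f : (BipEdge n → Bool) → BipVertex n → ℝ}
    (hf : ∀ v, IsLowDegree p D fun A => f A v) {c : ℝ} (hc : 0 < c) :
    ∑ e, cubePr p (fun x => c < ∑ v, cubeDeriv e (fun A => f A v) x ^ 2) ≤
      D * cubeE p (fun A => ∑ v, f A v ^ 2) / (c * (p * (1 - p))) := by
  have hv : 0 < p * (1 - p) := mul_pos h0 (by linarith)
  have hE : ∀ e, cubePr p (fun x => c < ∑ v, cubeDeriv e (fun A => f A v) x ^ 2) ≤
      (∑ v, cubeE p fun x => cubeDeriv e (fun A => f A v) x ^ 2) / c := by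
    intro e
    rw [← cubeE_sum]
    refine (cubePr_mono h0.le h1.le fun x hx => le_of_lt hx).trans
      (cubePr_markov h0.le h1.le (fun x => Finset.sum_nonneg fun v _ => sq_nonneg _) hc)
  refine (Finset.sum_le_sum fun e _ => hE e).trans ?_
  rw [← Finset.sum_div, div_le_div_iff₀ hc (mul_pos hc hv), Finset.sum_comm]
  have hsum : ∑ v, ∑ e, p * (1 - p) * cubeE p (fun x => cubeDeriv e (fun A => f A v) x ^ 2) ≤
      D * cubeE p (fun A => ∑ v, f A v ^ 2) := by
    rw [cubeE_sum, Finset.mul_sum]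
    exact Finset.sum_le_sum fun v _ => (hf v).total_influence_le h0.le h1.le
  simp only [← Finset.mul_sum] at hsum
  calc _ = p * (1 - p) * (∑ v, ∑ e, cubeE p fun x => cubeDeriv e (fun A => f A v) x ^ 2) * c := by
        ring
    _ ≤ _ := mul_le_mul_of_nonneg_right hsum hc.le

/-- Along a bad direction the graph stays put; along any other, `f` changes by zero or by plus or
minus its derivative, so by at most `c` in squared norm. Stability of rounding then gives jumps of
at most `4 c + η n ≤ q`. -/
lemma exists_chain_of_avoidsBad {T K s q : ℕ} {σ : ℕ → BipEdge n} {m : ℕ} (hT : T = K * m)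
    {η c : ℝ} (hs : 0 < s) (hq : 4 * c + η * n ≤ q) (hc : 0 ≤ c)
    {f : (BipEdge n → Bool) → BipVertex n → ℝ} (ω : Fin (T + 1) × BipEdge n → Bool)
    (hω : AvoidsBad σ (fun e x => c < ∑ v, cubeDeriv e (fun A => f A v) x ^ 2) ω T)
    (hsucc : ∀ t ≤ T, RoundsTo η s f (pathState σ ω t)) :
    (∃ L R : Finset (Fin n), L.card = s ∧ R.card = s ∧ EmptyAt σ ω 0 L R ∧
        Chain σ s q (fun _ _ _ _ => True) K 0 L R ω) ∨
      ∃ j ∈ Finset.range K, ∃ L R : Finset (Fin n), L.card = s ∧ R.card = s ∧ EmptyAt σ ω 0 L R ∧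
        Chain σ s q (LateEmpty σ m (s - q)) j 0 L R ω := by
  set V : ℕ → Finset (BipVertex n) := fun t =>
    roundITilde (pathState σ ω t) (f (pathState σ ω t))
  have hround : ∀ t ≤ T, _ := fun t ht =>
    roundedSet_eq_of_leftCard_pos (lt_of_lt_of_le hs (hsucc t ht).1)
  have hVL : ∀ t ≤ T, s ≤ (V t).toLeft.card := fun t ht => by
    rw [← leftCard_eq_card_toLeft, show V t = _ from (hround t ht).2.symm]
    exact (hsucc t ht).1
  have hVR : ∀ t ≤ T, s ≤ (V t).toRight.card := fun t ht => by
    rw [← rightCard_eq_card_toRight, show V t = _ from (hround t ht).2.symm]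
    exact (hsucc t ht).2
  have hemp : ∀ t ≤ T, EmptyAt σ ω t (V t).toLeft (V t).toRight := fun t _ i hi j hj =>
    roundITilde_independent _ _ (Finset.mem_toLeft.1 hi) (Finset.mem_toRight.1 hj)
  have hjump : ∀ t < T, (V t \ V (t + 1)).card ≤ q := by
    intro t ht
    have h1 := card_roundITilde_sdiff_le (A := pathState σ ω t) (x := f (pathState σ ω t))
      (hround (t + 1) ht).1
    have h2 : ∑ v, (f (pathState σ ω t) v - f (pathState σ ω (t + 1)) v) ^ 2 ≤ c := by
      by_cases hbad : c < ∑ v, cubeDeriv (σ t) (fun A => f A v) (pathState σ ω t) ^ 2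
      · rw [hω t ht hbad]
        simpa using hc
      · push Not at hbad
        have hcases : ∀ (x : BipEdge n → Bool) (e : BipEdge n) (b : Bool) (v : BipVertex n),
            (f x v - f (Function.update x e b) v) ^ 2 ≤ cubeDeriv e (fun A => f A v) x ^ 2 := by
          intro x e b v
          have hx : Function.update x e (x e) = x := by simp
          simp only [cubeDeriv]
          cases hxe : x e <;> rw [hxe] at hx <;> cases b <;> rw [hx]
          · simpa using sq_nonneg _
          · rw [sub_sq_comm]
          · simpa using sq_nonneg _
        refine le_trans (Finset.sum_le_sum fun v _ => ?_) hbad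
        rw [pathState_succ]
        exact hcases _ _ _ _
    have h3 : ((V t \ V (t + 1)).card : ℝ) ≤ q := by
      refine h1.trans (le_trans ?_ hq)
      linarith
    exact_mod_cast h3
  obtain ⟨L, hL, hLc⟩ := Finset.exists_subset_card_eq (hVL 0 (Nat.zero_le _))
  obtain ⟨R, hR, hRc⟩ := Finset.exists_subset_card_eq (hVR 0 (Nat.zero_le _))
  have hemp0 : EmptyAt σ ω 0 L R := fun i hi j hj => hemp 0 (Nat.zero_le _) i (hL hi) j (hR hj)
  have h := exists_chain_of_stable (m := m) (q := q) ω (fun t => (V t).toLeft)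
    (fun t => (V t).toRight) hemp hVL hVR
    (fun t ht => by
      rw [← Finset.toLeft_sdiff]
      exact Finset.card_toLeft_le.trans (hjump t ht))
    (fun t ht => by
      rw [← Finset.toRight_sdiff]
      exact Finset.card_toRight_le.trans (hjump t ht))
    K 0 L R (by omega)
    (by rw [Finset.inter_eq_right.2 hL, hLc]) (by rw [Finset.inter_eq_right.2 hR, hRc])
  rcases h with h | ⟨j, hj, h⟩
  · exact Or.inl ⟨L, R, hLc, hRc, hemp0, h⟩
  · exact Or.inr ⟨j, Finset.mem_range.2 hj, L, R, hLc, hRc, hemp0, h⟩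

/-- The quantitative obstruction: a stable low-degree map that succeeds with high probability
produces chains more often than the first moment allows. -/
lemma low_degree_obstruction (hn : 0 < n) {p : ℝ} (h0 : 0 < p) (h1 : p < 1) {D K s q : ℕ}
    {f : (BipEdge n → Bool) → BipVertex n → ℝ} (hf : ∀ v, IsLowDegree p D fun A => f A v)
    {η c : ℝ} (hs : 0 < s) (hq : 4 * c + η * n ≤ q) (hc : 0 < c) (hqs : q ≤ s) {z w : ℝ}
    (hz : 0 ≤ z) (hw0 : 0 ≤ w) (hw1 : w ≤ 1) (hzw : (1 - p) ^ (s - q) ≤ z * w) {β : ℝ}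
    (hβ : ((K * n ^ 2 : ℕ) + 1 : ℝ) * (w ^ q * (2 ^ ((K + 1) * s) * (1 + z) ^ n) ^ 2) ≤ β)
    (hβ1 : β ≤ 1) :
    Real.exp ((p * Real.log p + (1 - p) * Real.log (1 - p)) *
        (K * (D * cubeE p (fun A => ∑ v, f A v ^ 2) / (c * (p * (1 - p)))))) ≤
      ((K * n ^ 2 : ℕ) + 1 : ℝ) * cubePr p (fun A => ¬ RoundsTo η s f A) +
      (n.choose s : ℝ) ^ 2 * (1 - p) ^ (s * s) * (β ^ K +
        K * (((K * n ^ 2 : ℕ) + 1 : ℝ) * (2 ^ ((K + 1) * s)) ^ 2 *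
          (1 - p) ^ ((s - q) * (s - q)))) := by
  classical
  have : Nonempty (BipEdge n) := ⟨(⟨0, hn⟩, ⟨0, hn⟩)⟩
  have h1' : 0 ≤ 1 - p := by linarith
  have hcardE : Fintype.card (BipEdge n) = n ^ 2 := by simp [sq]
  set m := n ^ 2 with hm
  set T := K * m with hT
  set σ := sweep (BipEdge n) with hσ
  set M := (K + 1) * s with hM
  set Bad : BipEdge n → (BipEdge n → Bool) → Prop :=
    fun e x => c < ∑ v, cubeDeriv e (fun A => f A v) x ^ 2 with hBad
  have hσm : ∀ t₀ e, ∃ j, t₀ ≤ j ∧ j < t₀ + m ∧ σ j = e := by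
    intro t₀ e
    rw [← hcardE]
    exact exists_sweep_eq t₀ e
  have hentropy : p * Real.log p + (1 - p) * Real.log (1 - p) ≤ 0 :=
    add_nonpos (mul_nonpos_of_nonneg_of_nonpos h0.le (Real.log_nonpos h0.le h1.le))
      (mul_nonpos_of_nonneg_of_nonpos h1' (Real.log_nonpos h1' (by linarith)))
  have havoid := exp_le_cubePr_avoidsBad (T := T) (σ := σ) h0 h1 Bad (fun e x b => by
    simp [hBad, cubeDeriv])
  have hsumbad : ∑ j ∈ Finset.range T, cubePr p (Bad (σ j)) ≤
      K * (D * cubeE p (fun A => ∑ v, f A v ^ 2) / (c * (p * (1 - p)))) := by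
    rw [hT, ← hcardE, hσ, sum_range_sweep (fun e => cubePr p (Bad e)) K]
    exact mul_le_mul_of_nonneg_left (sum_cubePr_large_deriv_le h0 h1 hf hc) (by positivity)
  have hlow := (Real.exp_le_exp.2 (mul_le_mul_of_nonpos_left hsumbad hentropy)).trans havoid
  refine hlow.trans ?_
  set chT : (Fin (T + 1) × BipEdge n → Bool) → Prop := fun ω =>
    ∃ L R : Finset (Fin n), L.card = s ∧ R.card = s ∧ EmptyAt σ ω 0 L R ∧
        Chain σ s q (fun _ _ _ _ => True) K 0 L R ω with hchT
  set chL : ℕ → (Fin (T + 1) × BipEdge n → Bool) → Prop := fun j ω =>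
    ∃ L R : Finset (Fin n), L.card = s ∧ R.card = s ∧ EmptyAt σ ω 0 L R ∧
        Chain σ s q (LateEmpty σ m (s - q)) j 0 L R ω with hchL
  have hcover : ∀ ω : Fin (T + 1) × BipEdge n → Bool, AvoidsBad σ Bad ω T →
      (∃ t ∈ Finset.range (T + 1), ¬ RoundsTo η s f (pathState σ ω t)) ∨
        (chT ω ∨ ∃ j ∈ Finset.range K, chL j ω) := by
    intro ω hω
    by_cases hsucc : ∀ t ≤ T, RoundsTo η s f (pathState σ ω t)
    · exact Or.inr (exists_chain_of_avoidsBad hT hs hq hc.le ω hω hsucc)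
    · push Not at hsucc
      obtain ⟨t, ht, h⟩ := hsucc
      exact Or.inl ⟨t, Finset.mem_range.2 (by omega), h⟩
  -- By stationarity each of the `T + 1` times has the failure probability of a single random graph.
  have hfail : cubePr p (fun ω : Fin (T + 1) × BipEdge n → Bool =>
      ∃ t ∈ Finset.range (T + 1), ¬ RoundsTo η s f (pathState σ ω t)) ≤
      ((T : ℝ) + 1) * cubePr p (fun A => ¬ RoundsTo η s f A) := by
    refine (cubePr_exists_le h0.le h1.le _ _).trans (le_of_eq ?_)
    simp only [cubePr_pathState _ (fun A => ¬ RoundsTo η s f A)]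
    simp
  set β' := ((T : ℝ) + 1) * (w ^ q * (2 ^ M * (1 + z) ^ n) ^ 2) with hβ'
  have hβ'0 : 0 ≤ β' := by positivity
  have hZ : 0 ≤ (n.choose s : ℝ) ^ 2 * (1 - p) ^ (s * s) := by positivity
  have hT' : cubePr p chT ≤ (n.choose s : ℝ) ^ 2 * (1 - p) ^ (s * s) * β ^ K := by
    refine (cubePr_exists_chain_le (M := M) (B := 1) h0.le h1.le hqs hz hw0 hw1 hzw zero_le_one ?_ K
      le_rfl).trans ?_
    · intro t₀ WL WR U _ _ _
      simpa using (cubePr_forall_false (p := p) U).le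
    · rw [mul_one]
      exact mul_le_mul_of_nonneg_left (pow_le_pow_left₀ hβ'0 hβ _) hZ
  set B := ((T : ℝ) + 1) * (2 ^ M) ^ 2 * (1 - p) ^ ((s - q) * (s - q)) with hB
  have hB0 : 0 ≤ B := by positivity
  have hL' : ∀ j ∈ Finset.range K, cubePr p (chL j) ≤
      (n.choose s : ℝ) ^ 2 * (1 - p) ^ (s * s) * B := by
    intro j hj
    have hjK : j < K := Finset.mem_range.1 hj
    refine (cubePr_exists_chain_le (M := M) (B := B) h0.le h1.le hqs hz hw0 hw1 hzw hB0 ?_ j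
      (Nat.mul_le_mul_right _ (by omega))).trans ?_
    · intro t₀ WL WR U hWL hWR hU
      exact cubePr_lateEmpty_le h0.le h1.le hσm t₀ WL WR U hWL hWR hU
    -- For late rectangles the number `j` of recorded sets may be zero, so the factor `β' ^ j ≤ 1`
    -- is discarded.
    · refine mul_le_mul_of_nonneg_left ?_ hZ
      exact mul_le_of_le_one_left hB0 (pow_le_one₀ hβ'0 (hβ.trans hβ1))
  have hLsum : cubePr p (fun ω => ∃ j ∈ Finset.range K, chL j ω) ≤
      K * ((n.choose s : ℝ) ^ 2 * (1 - p) ^ (s * s) * B) := by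
    refine (cubePr_exists_le h0.le h1.le _ _).trans ((Finset.sum_le_sum hL').trans ?_)
    simp
  refine (cubePr_mono h0.le h1.le hcover).trans ((cubePr_or_le h0.le h1.le _ _).trans ?_)
  refine (add_le_add hfail ((cubePr_or_le h0.le h1.le _ _).trans (add_le_add hT' hLsum))).trans
    (le_of_eq ?_)
  ring

end Obstruction

/-! ### Numerical estimates -/

section Estimates

lemma one_sub_pow_le_exp {p : ℝ} (h1 : p ≤ 1) (k : ℕ) {y : ℝ} (hy : y ≤ p * k) :
    (1 - p) ^ k ≤ Real.exp (-y) := by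
  calc (1 - p) ^ k ≤ Real.exp (-p) ^ k :=
        pow_le_pow_left₀ (by linarith) (by linarith [Real.add_one_le_exp (-p)]) _
    _ = Real.exp (-(p * k)) := by rw [← Real.exp_nat_mul]; ring_nf
    _ ≤ _ := Real.exp_le_exp.2 (by linarith)

lemma two_pow_le_exp (k : ℕ) : (2 : ℝ) ^ k ≤ Real.exp k := by
  calc (2 : ℝ) ^ k ≤ Real.exp 1 ^ k :=
        pow_le_pow_left₀ (by norm_num) (by linarith [Real.add_one_le_exp 1]) _
    _ = Real.exp k := by rw [← Real.exp_nat_mul]; ring_nf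

lemma one_add_pow_le_exp {z : ℝ} (hz : 0 ≤ z) (k : ℕ) : (1 + z) ^ k ≤ Real.exp (z * k) := by
  calc (1 + z) ^ k ≤ Real.exp z ^ k :=
        pow_le_pow_left₀ (by linarith) (by linarith [Real.add_one_le_exp z]) _
    _ = Real.exp (z * k) := by rw [← Real.exp_nat_mul]; ring_nf

/-- The entropy is at most `p N + p`, hence of order `N p (1 - p)`. The factor `p (1 - p)` cancels
the one from the influence bound, leaving a cost of order `log n` when `N = log n`. -/
lemma neg_entropy_le {p N : ℝ} (h0 : 0 < p) (h1 : p ≤ 1 / 2) (hp : -Real.log p ≤ N) (hN : 1 ≤ N) :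
    -(p * Real.log p + (1 - p) * Real.log (1 - p)) ≤ 4 * N * (p * (1 - p)) := by
  have hsub : 0 < 1 - p := by linarith
  have hlog : 1 - (1 - p)⁻¹ ≤ Real.log (1 - p) := Real.one_sub_inv_le_log_of_pos hsub
  have h2 : -((1 - p) * Real.log (1 - p)) ≤ p := by
    have := mul_le_mul_of_nonneg_left hlog hsub.le
    rw [mul_sub, mul_inv_cancel₀ hsub.ne'] at this
    linarith
  have h3 : -(p * Real.log p) ≤ p * N := by nlinarith
  have h4 : p ≤ 2 * (p * (1 - p)) := by nlinarith
  nlinarith [mul_pos h0 hsub]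

/-- The hypotheses on the sizes under which the first-moment computation goes through; `l` is
`log d` and `Φ` is `(log d / d) n`. -/
structure SizeBounds (ε d l Φ : ℝ) (n K s q : ℕ) : Prop where
  ε_pos : 0 < ε
  ε_le : ε ≤ 1
  d_pos : 0 < d
  l_eq : l = Real.log d
  Φ_eq : Φ = l / d * n
  l_ge : 6 * ((K : ℝ) + 1) + 4 ≤ ε ^ 2 / 32 * l
  K_ge : 48 ≤ K * ε ^ 2
  Φ_ge : 8 ≤ ε * Φ
  l_le : l ≤ Φ
  time_le : ((K * n ^ 2 : ℕ) + 1 : ℝ) ≤ Real.exp Φ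
  n_ge : 2 * d ≤ n
  s_ge : (1 + ε) * Φ ≤ s
  s_le : s ≤ (1 + ε) * Φ + 1
  q_ge : ε / 8 * Φ ≤ q
  q_le : q ≤ ε / 8 * Φ + 1

namespace SizeBounds

variable {ε d l Φ : ℝ} {n K s q : ℕ}

lemma Φ_ge_eight (h : SizeBounds ε d l Φ n K s q) : 8 ≤ Φ := by
  have := h.Φ_ge
  have := h.ε_le
  have := h.ε_pos
  by_contra hc
  push Not at hc
  nlinarith

lemma l_ge_ten (h : SizeBounds ε d l Φ n K s q) : 10 ≤ l := by
  have h1 := h.l_ge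
  have h2 := h.ε_le
  have h3 := h.ε_pos
  have hK : (0 : ℝ) ≤ K := Nat.cast_nonneg K
  have h4 : ε ^ 2 / 32 ≤ 1 := by nlinarith
  have h5 : 0 ≤ l := by
    by_contra hc
    push Not at hc
    nlinarith [sq_nonneg ε]
  nlinarith

lemma n_pos (h : SizeBounds ε d l Φ n K s q) : (0 : ℝ) < n := by linarith [h.n_ge, h.d_pos]

lemma prob_pos (h : SizeBounds ε d l Φ n K s q) : 0 < d / n := div_pos h.d_pos h.n_pos

lemma prob_le (h : SizeBounds ε d l Φ n K s q) : d / n ≤ 1 / 2 := by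
  rw [div_le_div_iff₀ h.n_pos (by norm_num)]
  linarith [h.n_ge]

lemma prob_mul_Φ (h : SizeBounds ε d l Φ n K s q) : d / n * Φ = l := by
  have := h.n_pos
  have := h.d_pos
  rw [h.Φ_eq]
  field_simp

lemma n_div_d_le (h : SizeBounds ε d l Φ n K s q) : d⁻¹ * n ≤ Φ := by
  have hl := h.l_ge_ten
  have : 0 ≤ d⁻¹ * (n : ℝ) := mul_nonneg (inv_nonneg.2 h.d_pos.le) h.n_pos.le
  rw [h.Φ_eq, div_mul_eq_mul_div, mul_div_assoc, div_eq_inv_mul]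
  nlinarith

lemma inv_d_eq (h : SizeBounds ε d l Φ n K s q) : d⁻¹ = Real.exp (-l) := by
  rw [Real.exp_neg, h.l_eq, Real.exp_log h.d_pos]

lemma q_le_quarter (h : SizeBounds ε d l Φ n K s q) : (q : ℝ) ≤ ε / 4 * Φ := by
  linarith [h.q_le, h.Φ_ge]

lemma q_le_s (h : SizeBounds ε d l Φ n K s q) : q ≤ s := by
  have h1 := h.q_le_quarter
  have h2 := h.s_ge
  have h3 := h.Φ_ge_eight
  have h4 := h.ε_pos
  have : (q : ℝ) ≤ s := by nlinarith
  exact_mod_cast this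

lemma s_pos (h : SizeBounds ε d l Φ n K s q) : 0 < s := by
  have h2 := h.s_ge
  have h3 := h.Φ_ge_eight
  have h4 := h.ε_pos
  have : (0 : ℝ) < s := by nlinarith
  exact_mod_cast this

lemma r_ge (h : SizeBounds ε d l Φ n K s q) : (1 + 3 * ε / 4) * Φ ≤ (s - q : ℕ) := by
  rw [Nat.cast_sub h.q_le_s]
  linarith [h.q_le_quarter, h.s_ge]

lemma s_le_three (h : SizeBounds ε d l Φ n K s q) : (s : ℝ) ≤ 3 * Φ := by
  have h1 := h.s_le
  have h2 := h.Φ_ge_eight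
  have h3 := h.ε_le
  nlinarith

lemma prob_mul_r (h : SizeBounds ε d l Φ n K s q) : (1 + 3 * ε / 4) * l ≤ d / n * (s - q : ℕ) := by
  have := mul_le_mul_of_nonneg_left h.r_ge h.prob_pos.le
  have h2 := h.prob_mul_Φ
  calc (1 + 3 * ε / 4) * l = d / n * ((1 + 3 * ε / 4) * Φ) := by rw [← h2]; ring
    _ ≤ _ := this

/-- The exponent exceeds `log d` because `s - q` is still above the threshold; this is the splitting
`z = 1 / d`, `w = exp (-(3 ε / 4) l)` of the overlap sum. -/
lemma pow_le_inv_mul_exp (h : SizeBounds ε d l Φ n K s q) :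
    (1 - d / n) ^ (s - q) ≤ d⁻¹ * Real.exp (-(3 * ε / 4 * l)) := by
  refine (one_sub_pow_le_exp (by linarith [h.prob_le]) _ h.prob_mul_r).trans (le_of_eq ?_)
  rw [h.inv_d_eq, ← Real.exp_add]
  ring_nf

lemma two_pow_sq_le (h : SizeBounds ε d l Φ n K s q) :
    ((2 : ℝ) ^ ((K + 1) * s)) ^ 2 ≤ Real.exp (6 * (K + 1) * Φ) := by
  refine (pow_le_pow_left₀ (by positivity) (two_pow_le_exp _) 2).trans ?_
  rw [← Real.exp_nat_mul]
  refine Real.exp_le_exp.2 ?_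
  push_cast
  have hK : (0 : ℝ) ≤ K := Nat.cast_nonneg K
  nlinarith [h.s_le_three]

/-- The gain `w ^ q` is at most `exp (-(3 ε ^ 2 / 32) l Φ)`. All entropy terms together are `exp ((6
(K + 1) + 3) Φ)`, which `l_ge` makes at most a third of the gain. -/
lemma step_le (h : SizeBounds ε d l Φ n K s q) : ((K * n ^ 2 : ℕ) + 1 : ℝ) *
      (Real.exp (-(3 * ε / 4 * l)) ^ q * (2 ^ ((K + 1) * s) * (1 + d⁻¹) ^ n) ^ 2) ≤
    Real.exp (-(ε ^ 2 / 16 * l * Φ)) := by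
  have hd := h.d_pos
  have hΦ := h.Φ_ge_eight
  have hl := h.l_ge_ten
  have hε := h.ε_pos
  have h1 : Real.exp (-(3 * ε / 4 * l)) ^ q ≤ Real.exp (-(3 * ε ^ 2 / 32 * l * Φ)) := by
    rw [← Real.exp_nat_mul]
    refine Real.exp_le_exp.2 ?_
    have hle := mul_le_mul_of_nonneg_left h.q_ge (show 0 ≤ 3 * ε / 4 * l by positivity)
    nlinarith
  have h2 : ((1 + d⁻¹) ^ n) ^ 2 ≤ Real.exp (2 * Φ) := by
    refine (pow_le_pow_left₀ (by positivity) (one_add_pow_le_exp (by positivity) n) 2).trans ?_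
    rw [← Real.exp_nat_mul]
    refine Real.exp_le_exp.2 ?_
    push_cast
    linarith [h.n_div_d_le]
  calc _ ≤ Real.exp Φ * (Real.exp (-(3 * ε ^ 2 / 32 * l * Φ)) *
        (Real.exp (6 * (K + 1) * Φ) * Real.exp (2 * Φ))) := by
        refine mul_le_mul h.time_le ?_ (by positivity) (Real.exp_pos _).le
        refine mul_le_mul h1 ?_ (by positivity) (Real.exp_pos _).le
        rw [mul_pow]
        exact mul_le_mul h.two_pow_sq_le h2 (by positivity) (Real.exp_pos _).le
    _ = Real.exp (Φ + (-(3 * ε ^ 2 / 32 * l * Φ) + (6 * (K + 1) * Φ + 2 * Φ))) := by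
        simp only [Real.exp_add]
    _ ≤ _ := by
        refine Real.exp_le_exp.2 ?_
        have := mul_le_mul_of_nonneg_right h.l_ge (show 0 ≤ Φ by linarith)
        nlinarith

/-- The bounds `n.choose s ≤ d ^ s * exp (n / d)` and `(1 - p) ^ (s * s) ≤ d ^ (-(1 + ε) s)` leave
the exponent `(1 - ε) l s + 2 Φ`. It can be positive, so one independent set alone gives no
contradiction. -/
lemma first_le (h : SizeBounds ε d l Φ n K s q) :
    (n.choose s : ℝ) ^ 2 * (1 - d / n) ^ (s * s) ≤ Real.exp (l * Φ + 3 * Φ) := by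
  have hd := h.d_pos
  have hΦ := h.Φ_ge_eight
  have hl := h.l_ge_ten
  have hε := h.ε_pos
  have h1 : (n.choose s : ℝ) ≤ Real.exp (l * s + Φ) := by
    have hc := (choose_mul_pow_le (n := n) (inv_nonneg.2 hd.le) s).trans
      (one_add_pow_le_exp (inv_nonneg.2 hd.le) n)
    have hz : (d⁻¹ : ℝ) ^ s = Real.exp (-(l * s)) := by
      rw [h.inv_d_eq, ← Real.exp_nat_mul]
      ring_nf
    rw [hz, Real.exp_neg, ← div_eq_mul_inv, div_le_iff₀ (Real.exp_pos _), ← Real.exp_add] at hc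
    exact hc.trans (Real.exp_le_exp.2 (by linarith [h.n_div_d_le]))
  have hps : (1 + ε) * l ≤ d / n * s := by
    have h2 := mul_le_mul_of_nonneg_left h.s_ge h.prob_pos.le
    calc (1 + ε) * l = d / n * ((1 + ε) * Φ) := by rw [← h.prob_mul_Φ]; ring
      _ ≤ _ := h2
  have h2 : (1 - d / n) ^ (s * s) ≤ Real.exp (-((1 + ε) * l * s)) := by
    refine one_sub_pow_le_exp (by linarith [h.prob_le]) _ ?_
    push_cast
    rw [← mul_assoc]
    exact mul_le_mul_of_nonneg_right hps (Nat.cast_nonneg _)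
  calc _ ≤ Real.exp (l * s + Φ) ^ 2 * Real.exp (-((1 + ε) * l * s)) := by
        refine mul_le_mul (pow_le_pow_left₀ (by positivity) h1 2) h2 ?_ (by positivity)
        exact pow_nonneg (by linarith [h.prob_le]) _
    _ = Real.exp ((1 - ε) * l * s + 2 * Φ) := by
        rw [← Real.exp_nat_mul, ← Real.exp_add]
        push_cast
        ring_nf
    _ ≤ _ := by
        refine Real.exp_le_exp.2 ?_
        have h3 : (1 - ε) * l * s ≤ (1 - ε) * l * ((1 + ε) * Φ + 1) :=
          mul_le_mul_of_nonneg_left h.s_le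
            (mul_nonneg (by linarith [h.ε_le]) (by linarith))
        have h4 : (1 - ε) * l * ((1 + ε) * Φ + 1) = l * Φ + l - ε ^ 2 * (l * Φ) - ε * l := by ring
        have h5 : 0 ≤ ε ^ 2 * (l * Φ) := by positivity
        have h6 : 0 ≤ ε * l := by positivity
        linarith [h.l_le]

lemma first_moment_le (h : SizeBounds ε d l Φ n K s q) :
    (n.choose s : ℝ) ^ 2 * (1 - d / n) ^ (s * s) * (Real.exp (-(ε ^ 2 / 16 * l * Φ)) ^ K +
        K * (((K * n ^ 2 : ℕ) + 1 : ℝ) * (2 ^ ((K + 1) * s)) ^ 2 *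
          (1 - d / n) ^ ((s - q) * (s - q)))) ≤ (K + 1) * Real.exp (-(ε * l * Φ)) := by
  have hd := h.d_pos
  have hΦ := h.Φ_ge_eight
  have hl := h.l_ge_ten
  have hε := h.ε_pos
  have hp : 0 ≤ 1 - d / n := by linarith [h.prob_le]
  have hlΦ : 0 ≤ l * Φ := by positivity
  have hZ0 : 0 ≤ (n.choose s : ℝ) ^ 2 * (1 - d / n) ^ (s * s) := by positivity
  -- The constant `48` in `K_ge` makes the `K` steps worth `exp (-3 l Φ)`, against `l Φ + 3 Φ ≤ 2 l
  -- Φ` for the start.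
  have hA : (n.choose s : ℝ) ^ 2 * (1 - d / n) ^ (s * s) * Real.exp (-(ε ^ 2 / 16 * l * Φ)) ^ K ≤
      Real.exp (-(ε * l * Φ)) := by
    refine (mul_le_mul_of_nonneg_right h.first_le (by positivity)).trans ?_
    rw [← Real.exp_nat_mul, ← Real.exp_add]
    refine Real.exp_le_exp.2 ?_
    have h1 := mul_le_mul_of_nonneg_right h.K_ge hlΦ
    have h2 : ε * (l * Φ) ≤ l * Φ := by nlinarith [h.ε_le]
    have h3 : 3 * Φ ≤ l * Φ := by nlinarith
    nlinarith
  -- Both sides of the rectangle exceed the threshold by `1 + 3 ε / 4`, and the square exceeds `1 +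
  -- 3 ε / 2`; the `1` pays for the initial set and `3 ε / 2` covers the rest.
  have hr : (1 - d / n) ^ ((s - q) * (s - q)) ≤ Real.exp (-((1 + 3 * ε / 2) * (l * Φ))) := by
    refine one_sub_pow_le_exp (by linarith [h.prob_le]) _ ?_
    have h1 := h.prob_mul_r
    have h2 := h.r_ge
    push_cast
    rw [← mul_assoc (d / n)]
    calc (1 + 3 * ε / 2) * (l * Φ) ≤ ((1 + 3 * ε / 4) * l) * ((1 + 3 * ε / 4) * Φ) := by
          have : 0 ≤ ε ^ 2 * (l * Φ) := by positivity
          nlinarith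
      _ ≤ _ := mul_le_mul h1 h2 (by positivity) (le_trans (by positivity) h1)
  have hB : (n.choose s : ℝ) ^ 2 * (1 - d / n) ^ (s * s) *
      (((K * n ^ 2 : ℕ) + 1 : ℝ) * (2 ^ ((K + 1) * s)) ^ 2 *
          (1 - d / n) ^ ((s - q) * (s - q))) ≤ Real.exp (-(ε * l * Φ)) := by
    calc _ ≤ Real.exp (l * Φ + 3 * Φ) * (Real.exp Φ * Real.exp (6 * (K + 1) * Φ) *
          Real.exp (-((1 + 3 * ε / 2) * (l * Φ)))) := by
          refine mul_le_mul h.first_le ?_ (by positivity) (Real.exp_pos _).le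
          refine mul_le_mul ?_ hr (by positivity) (by positivity)
          exact mul_le_mul h.time_le h.two_pow_sq_le (by positivity) (Real.exp_pos _).le
      _ = Real.exp (l * Φ + 3 * Φ + (Φ + 6 * (K + 1) * Φ + -((1 + 3 * ε / 2) * (l * Φ)))) := by
          simp only [Real.exp_add]
      _ ≤ _ := by
          refine Real.exp_le_exp.2 ?_
          have h1 := mul_le_mul_of_nonneg_right h.l_ge (show 0 ≤ Φ by linarith)
          have h2 : ε ^ 2 / 32 * (l * Φ) ≤ ε / 2 * (l * Φ) :=
            mul_le_mul_of_nonneg_right (by nlinarith [h.ε_le]) hlΦ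
          nlinarith
  have hK : (0 : ℝ) ≤ K := Nat.cast_nonneg K
  nlinarith [mul_le_mul_of_nonneg_left hB hK]

end SizeBounds

end Estimates

/-! ### Hardness for deterministic low-degree maps -/

section Hardness

open Filter

lemma eventually_mul_sq_add_one_le_exp (K : ℝ) {a : ℝ} (ha : 0 < a) :
    ∀ᶠ n : ℕ in atTop, K * (n : ℝ) ^ 2 + 1 ≤ Real.exp (a * n) := by
  have h1 := (isLittleO_pow_exp_pos_mul_atTop 3 ha).comp_tendsto tendsto_natCast_atTop_atTop
  have h2 := h1.def (show (0 : ℝ) < 1 by norm_num)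
  filter_upwards [h2, eventually_ge_atTop 1,
    tendsto_natCast_atTop_atTop.eventually_ge_atTop (K + 1)] with n hn hn1 hnK
  have hn1' : (1 : ℝ) ≤ n := by exact_mod_cast hn1
  simp only [Function.comp, norm_pow, Real.norm_eq_abs, Real.abs_exp, Nat.abs_cast,
    one_mul] at hn
  refine le_trans ?_ hn
  nlinarith [mul_le_mul_of_nonneg_right hnK (sq_nonneg (n : ℝ))]

lemma eventually_mul_sq_add_one_le_pow (K : ℝ) :
    ∀ᶠ n : ℕ in atTop, 6 * (K * (n : ℝ) ^ 2 + 1) ≤ (n : ℝ) ^ 5 := by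
  filter_upwards [eventually_ge_atTop 2,
    tendsto_natCast_atTop_atTop.eventually_ge_atTop (6 * K + 6)] with n hn1 hnK
  have hn1' : (2 : ℝ) ≤ n := by exact_mod_cast hn1
  have h1 : (1 : ℝ) ≤ (n : ℝ) ^ 2 := by nlinarith
  have h2 : (6 * K + 6) * (n : ℝ) ^ 2 ≤ n * (n : ℝ) ^ 2 :=
    mul_le_mul_of_nonneg_right hnK (by positivity)
  have h3 : (n : ℝ) ^ 3 ≤ (n : ℝ) ^ 5 := pow_le_pow_right₀ (by linarith) (by norm_num)
  nlinarith

lemma eventually_le_mul_natCast (b : ℝ) {a : ℝ} (ha : 0 < a) : ∀ᶠ n : ℕ in atTop, b ≤ a * n :=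
  (tendsto_natCast_atTop_atTop.const_mul_atTop ha).eventually_ge_atTop b

set_option maxHeartbeats 1000000 in
/-- No low-degree map with small second moment rounds to large balanced independent sets with
overwhelming probability. -/
lemma low_degree_hardness {ε : ℝ} (hε : 0 < ε) (hε1 : ε ≤ 1) :
    ∃ d₀ : ℝ, 0 < d₀ ∧ ∀ d : ℝ, d₀ ≤ d →
      ∃ (n₀ : ℕ) (η C₁ C₂ : ℝ), 0 < n₀ ∧ 0 < η ∧ 0 < C₁ ∧ 0 < C₂ ∧
      ∀ n : ℕ, n₀ ≤ n → 2 * d ≤ n ∧ 0 < (1 + ε) * (Real.log d / d) * n ∧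
      ∀ ξ : ℝ, 1 ≤ ξ → ∀ D : ℕ, 1 ≤ D → (D : ℝ) ≤ C₁ * n / (ξ * Real.log n) →
      Real.exp (-(C₂ * ξ * D * Real.log n)) < 1 / 3 ∧
      ∀ f : (BipEdge n → Bool) → BipVertex n → ℝ, (∀ v, IsLowDegree (d / n) D fun A => f A v) →
        cubeE (d / n) (fun A => ∑ v, f A v ^ 2) ≤ 6 * ξ * n →
        ¬ cubePr (d / n) (fun A => ¬ RoundsTo η ⌈(1 + ε) * (Real.log d / d) * n⌉₊ f A) ≤
          3 * Real.exp (-(C₂ * ξ * D * Real.log n)) := by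
  set K : ℕ := ⌈48 / ε ^ 2⌉₊ with hK
  have hKε : 48 ≤ K * ε ^ 2 := by
    have := Nat.le_ceil (48 / ε ^ 2)
    rwa [div_le_iff₀ (by positivity)] at this
  -- This `d₀` is what makes `log d` satisfy `l_ge` for the chosen `K`.
  refine ⟨Real.exp ((6 * ((K : ℝ) + 1) + 4) / (ε ^ 2 / 32)), Real.exp_pos _, fun d hd => ?_⟩
  have hd0 : 0 < d := lt_of_lt_of_le (Real.exp_pos _) hd
  set l := Real.log d with hl
  have hlge : (6 * ((K : ℝ) + 1) + 4) / (ε ^ 2 / 32) ≤ l := by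
    rw [hl, Real.le_log_iff_exp_le hd0]
    exact hd
  have hlge' : 6 * ((K : ℝ) + 1) + 4 ≤ ε ^ 2 / 32 * l := by
    rw [div_le_iff₀ (by positivity)] at hlge
    linarith
  have hl0 : 0 < l := lt_of_lt_of_le (by positivity) hlge
  have hd1 : 1 ≤ d := by
    by_contra hc
    push Not at hc
    have := Real.log_neg hd0 hc
    linarith
  have ha : 0 < l / d := div_pos hl0 hd0
  set θ := ε / 8 * (l / d) with hθ
  have hθ0 : 0 < θ := by positivity
  set κ := ε * l * (l / d) with hκ
  have hκ0 : 0 < κ := by positivity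
  have hK0 : (0 : ℝ) < K := by
    by_contra hc
    push Not at hc
    nlinarith [sq_nonneg ε]
  set C := 192 * K / θ with hC
  have hC0 : 0 < C := by positivity
  obtain ⟨n₁, hn₁⟩ := eventually_atTop.1
    ((eventually_mul_sq_add_one_le_exp K ha).and <| (eventually_mul_sq_add_one_le_pow K).and <|
      (eventually_le_mul_natCast 8 (mul_pos hε ha)).and <| (eventually_le_mul_natCast l ha).and <|
      (eventually_le_mul_natCast (2 * d) one_pos).and <|
      (eventually_le_mul_natCast (2 * ((K : ℝ) + 1)) (half_pos hκ0)).and <|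
      eventually_ge_atTop 3)
  -- `η = θ / 2`, together with `c = θ n / 8` below, gives `4 c + η n = (ε / 8) Φ ≤ q`. `C₁` ensures
  -- `C X ≤ (κ / 2) n`, half the exponent of the first-moment bound. The surplus `5` in `C₂` yields
  -- a factor `n ^ (-5)` that absorbs the union over times.
  refine ⟨max n₁ 1, θ / 2, κ / (2 * C), C + 5, by simp, by positivity, by positivity,
    by positivity, fun n hn => ?_⟩
  obtain ⟨e1, e2, e3, e4, e5, e6, e7⟩ := hn₁ n ((le_max_left _ _).trans hn)
  rw [one_mul] at e5
  have hn3 : (3 : ℝ) ≤ n := by exact_mod_cast e7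
  have hn0 : (0 : ℝ) < n := by linarith
  refine ⟨e5, by positivity, ?_⟩
  intro ξ hξ D hD hDle
  have hlogn : 1 ≤ Real.log n := by
    rw [Real.le_log_iff_exp_le hn0]
    linarith [Real.exp_one_lt_d9]
  have hD1 : (1 : ℝ) ≤ D := by exact_mod_cast hD
  have hξD : 1 ≤ ξ * D := by nlinarith
  set X := ξ * D * Real.log n with hX
  have hX1 : Real.log n ≤ X := by
    rw [hX]
    nlinarith
  have hXC : C * X ≤ κ / 2 * n := by
    rw [le_div_iff₀ (by positivity)] at hDle
    calc C * X = C * (D * (ξ * Real.log n)) := by rw [hX]; ring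
      _ ≤ C * (κ / (2 * C) * n) := mul_le_mul_of_nonneg_left hDle hC0.le
      _ = κ / 2 * n := by field_simp
  have hδX : Real.exp (-((C + 5) * ξ * D * Real.log n)) ≤ Real.exp (-(C * X)) / (n : ℝ) ^ 5 := by
    have h5 : (n : ℝ) ^ 5 = Real.exp (5 * Real.log n) := by
      rw [show (5 : ℝ) * Real.log n = (5 : ℕ) * Real.log n by norm_num, Real.exp_nat_mul,
        Real.exp_log hn0]
    rw [h5, ← Real.exp_sub]
    refine Real.exp_le_exp.2 ?_
    have : (C + 5) * ξ * D * Real.log n = C * X + 5 * X := by rw [hX]; ring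
    linarith
  have hδ3 : Real.exp (-((C + 5) * ξ * D * Real.log n)) < 1 / 3 := by
    refine lt_of_le_of_lt hδX ?_
    have hX0 : 0 ≤ C * X := mul_nonneg hC0.le (by linarith)
    have h1 : Real.exp (-(C * X)) ≤ 1 := Real.exp_le_one_iff.2 (by linarith)
    have h2 : (3 : ℝ) ^ 5 ≤ (n : ℝ) ^ 5 := pow_le_pow_left₀ (by norm_num) hn3 5
    rw [div_lt_div_iff₀ (by positivity) (by norm_num)]
    linarith
  refine ⟨hδ3, fun f hf hfΓ hfail => ?_⟩
  set Φ := l / d * n with hΦ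
  have hΦ0 : 0 ≤ Φ := by positivity
  set s := ⌈(1 + ε) * (l / d) * n⌉₊ with hs
  set q := ⌈ε / 8 * Φ⌉₊ with hq
  have hsΦ : (1 + ε) * (l / d) * n = (1 + ε) * Φ := by rw [hΦ]; ring
  have hS : SizeBounds ε d l Φ n K s q := by
    refine ⟨hε, hε1, hd0, rfl, rfl, hlge', hKε, ?_, e4, ?_, e5, ?_, ?_, Nat.le_ceil _,
      (Nat.ceil_lt_add_one (by positivity)).le⟩
    · rw [hΦ]; linarith
    · push_cast
      exact e1
    · rw [← hsΦ]; exact Nat.le_ceil _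
    · rw [← hsΦ]; exact (Nat.ceil_lt_add_one (by positivity)).le
  have hp0 := hS.prob_pos
  have hp1 := hS.prob_le
  set p := d / (n : ℝ) with hp
  have hv : 0 < p * (1 - p) := mul_pos hp0 (by linarith)
  have hmain := low_degree_obstruction (n := n) (K := K) (c := θ * n / 8) (η := θ / 2)
    (by exact_mod_cast hn0) hp0 (by linarith) hf hS.s_pos
    (by
      refine le_trans (le_of_eq ?_) hS.q_ge
      rw [hΦ, hθ]; ring)
    (by positivity) hS.q_le_s (inv_nonneg.2 hd0.le) (Real.exp_pos _).le
    (Real.exp_le_one_iff.2 (by nlinarith [mul_pos hε hl0]))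
    hS.pow_le_inv_mul_exp hS.step_le
    (Real.exp_le_one_iff.2 (by
      have : 0 ≤ ε ^ 2 / 16 * l * Φ := by positivity
      linarith))
  -- Entropy, influence and `E ‖f‖² ≤ 6 ξ n` multiply to `4 · 8 · 6 · K X / θ = C X`, which is where
  -- `192` comes from.
  have hlow : Real.exp (-(C * X)) ≤ Real.exp ((p * Real.log p + (1 - p) * Real.log (1 - p)) *
        (K * (D * cubeE p (fun A => ∑ v, f A v ^ 2) / (θ * n / 8 * (p * (1 - p)))))) := by
    refine Real.exp_le_exp.2 ?_
    have hent := neg_entropy_le (N := Real.log n) hp0 hp1 (by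
      rw [hp, Real.log_div hd0.ne' hn0.ne']
      linarith) hlogn
    have hΓ0 : 0 ≤ cubeE p (fun A => ∑ v, f A v ^ 2) :=
      cubeE_nonneg hp0.le (by linarith) fun x => Finset.sum_nonneg fun v _ => sq_nonneg _
    set Γ := cubeE p (fun A => ∑ v, f A v ^ 2) with hΓ
    have hQ : 0 ≤ K * (D * Γ / (θ * n / 8 * (p * (1 - p)))) := by positivity
    have h1 := mul_le_mul_of_nonneg_right hent hQ
    have h2 : 4 * Real.log n * (p * (1 - p)) * (K * (D * Γ / (θ * n / 8 * (p * (1 - p))))) =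
        32 * K * Real.log n * D / (θ * n) * Γ := by
      have : 1 - p ≠ 0 := by linarith
      field_simp
      ring
    have h3 : 32 * K * Real.log n * D / (θ * n) * Γ ≤
        32 * K * Real.log n * D / (θ * n) * (6 * ξ * n) :=
      mul_le_mul_of_nonneg_left hfΓ (by positivity)
    have h4 : 32 * K * Real.log n * D / (θ * n) * (6 * ξ * n) = C * X := by
      rw [hC, hX]
      field_simp
      ring
    linarith
  have hfirst := hS.first_moment_le
  have hfail' : ((K * n ^ 2 : ℕ) + 1 : ℝ) * cubePr p (fun A => ¬ RoundsTo (θ / 2) s f A) ≤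
      1 / 2 * Real.exp (-(C * X)) := by
    push_cast
    have hT0 : (0 : ℝ) ≤ K * n ^ 2 + 1 := by positivity
    calc _ ≤ ((K : ℝ) * n ^ 2 + 1) * (3 * (Real.exp (-(C * X)) / (n : ℝ) ^ 5)) := by
          refine mul_le_mul_of_nonneg_left (hfail.trans ?_) hT0
          linarith
      _ = (6 * ((K : ℝ) * n ^ 2 + 1) / (n : ℝ) ^ 5) * (1 / 2 * Real.exp (-(C * X))) := by
          field_simp
          ring
      _ ≤ 1 * (1 / 2 * Real.exp (-(C * X))) := by
          refine mul_le_mul_of_nonneg_right ?_ (by positivity)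
          rw [div_le_one (by positivity)]
          exact e2
      _ = _ := one_mul _
  -- The first moment is `exp (-κ n)` up to a constant: one half of the exponent beats `2 (K + 1)`,
  -- the other is at most `exp (-(C X))`.
  have hstrict : ((K : ℝ) + 1) * Real.exp (-(ε * l * Φ)) < 1 / 2 * Real.exp (-(C * X)) := by
    have hκn : ε * l * Φ = κ * n := by rw [hΦ, hκ]; ring
    have h1 : Real.exp (-(κ / 2 * n)) ≤ Real.exp (-(C * X)) := Real.exp_le_exp.2 (by linarith)
    have h2 : Real.exp (-(ε * l * Φ)) = Real.exp (-(κ / 2 * n)) * Real.exp (-(κ / 2 * n)) := by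
      rw [hκn, ← Real.exp_add]
      ring_nf
    have h3 : 2 * ((K : ℝ) + 1) < Real.exp (κ / 2 * n) := by
      linarith [Real.add_one_le_exp (κ / 2 * n)]
    have h4 : ((K : ℝ) + 1) * Real.exp (-(κ / 2 * n)) < 1 / 2 := by
      rw [Real.exp_neg, ← div_eq_mul_inv, div_lt_div_iff₀ (Real.exp_pos _) (by norm_num)]
      linarith
    rw [h2]
    nlinarith [Real.exp_pos (-(κ / 2 * n))]
  linarith

end Hardness

/-! ### The random bipartite graph as a biased cube -/

section RandomBip

variable {n : ℕ} {d : ℝ}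

instance : IsProbabilityMeasure (randomBip n d) := by
  unfold randomBip
  infer_instance

lemma coe_edgeProb (h0 : 0 ≤ d) (hn : d ≤ n) : (edgeProb n d : ℝ) = d / n := by
  have h : d / n ∈ Set.Icc (0 : ℝ) 1 :=
    ⟨div_nonneg h0 (Nat.cast_nonneg n), div_le_one_of_le₀ hn (Nat.cast_nonneg n)⟩
  rw [edgeProb, Set.projIcc_of_mem _ h]

lemma randomBip_singleton (h0 : 0 ≤ d) (hn : d ≤ n) (A : BipEdge n → Bool) :
    randomBip n d {A} = ENNReal.ofReal (cubeWeight (d / n) A) := by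
  have hp1 : d / n ≤ 1 := div_le_one_of_le₀ hn (Nat.cast_nonneg n)
  have hp0 : 0 ≤ d / n := div_nonneg h0 (Nat.cast_nonneg n)
  rw [randomBip, Measure.pi_singleton, cubeWeight, ENNReal.ofReal_prod_of_nonneg]
  · refine Finset.prod_congr rfl fun e _ => ?_
    have hr : (bernoulliMeasure true false (edgeProb n d)).real {A e} =
        if A e = true then d / n else 1 - d / n := by
      rw [bernoulliMeasure_real_apply _ (MeasurableSet.singleton _)]
      cases A e <;> simp [coe_edgeProb h0 hn]
    rw [← hr, ofReal_measureReal]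
  · intro e _
    split_ifs <;> linarith

lemma lintegral_randomBip (h0 : 0 ≤ d) (hn : d ≤ n) {F : (BipEdge n → Bool) → ℝ}
    (hF : ∀ A, 0 ≤ F A) :
    ∫⁻ A, ENNReal.ofReal (F A) ∂(randomBip n d) = ENNReal.ofReal (cubeE (d / n) F) := by
  have hp1 : d / n ≤ 1 := div_le_one_of_le₀ hn (Nat.cast_nonneg n)
  have hp0 : 0 ≤ d / n := div_nonneg h0 (Nat.cast_nonneg n)
  rw [lintegral_fintype, cubeE, ENNReal.ofReal_sum_of_nonneg]
  · refine Finset.sum_congr rfl fun A _ => ?_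
    rw [randomBip_singleton h0 hn, ENNReal.ofReal_mul (cubeWeight_nonneg hp0 hp1 A), mul_comm]
  · exact fun A _ => mul_nonneg (cubeWeight_nonneg hp0 hp1 A) (hF A)

lemma randomBip_apply (h0 : 0 ≤ d) (hn : d ≤ n) (Q : (BipEdge n → Bool) → Prop) :
    randomBip n d {A | Q A} = ENNReal.ofReal (cubePr (d / n) Q) := by
  classical
  rw [cubePr, ← lintegral_randomBip h0 hn, ← lintegral_indicator_one (Set.toFinite _).measurableSet]
  · refine lintegral_congr fun A => ?_
    by_cases h : Q A <;> simp [h]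
  · intro A
    split_ifs <;> norm_num

end RandomBip

/-! ### Measurability of random polynomials and of rounding -/

section Measurability

variable {n : ℕ}

/-- The support of `f ω v` varies with `ω`; the degree bound allows summing over one fixed finite
set of monomials. -/
lemma measurable_eval {Ω : Type*} [MeasurableSpace Ω] {D : ℕ} {f : Ω → BipPoly n}
    (hf : IsRandomPoly D f) (A : BipEdge n → Bool) (v : BipVertex n) :
    Measurable fun ω => (f ω).value A v := by
  classical
  set F : Finset (BipEdge n →₀ ℕ) :=
    (Finset.range (D + 1)).biUnion fun k => Finset.univ.finsuppAntidiag k with hF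
  have hval : ∀ ω, (f ω).value A v =
      ∑ m ∈ F, (f ω v).coeff m * ∏ i ∈ m.support, edgeVector A i ^ m i := by
    intro ω
    rw [BipPoly.value, MvPolynomial.eval_eq]
    refine Finset.sum_subset (fun m hm => ?_) fun m _ hm => ?_
    · have h1 := (MvPolynomial.le_totalDegree hm).trans (hf.degreeLE ω v)
      rw [hF, Finset.mem_biUnion]
      refine ⟨∑ i, m i, ?_, ?_⟩
      · rw [Finset.mem_range, ← Finsupp.sum_fintype m (fun _ e => e) (fun _ => rfl)]
        omega
      · simp [Finset.mem_finsuppAntidiag]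
    · rw [MvPolynomial.notMem_support_iff.1 hm, zero_mul]
  simp only [hval]
  exact Finset.measurable_sum _ fun m _ => (hf.measurable_coeff v m).mul_const _

lemma roundedSet_congr {η : ℝ} (A : BipEdge n → Bool) {x y : BipVertex n → ℝ}
    (hI : roundI x = roundI y) (hJ : roundJ x = roundJ y) :
    roundedSet η A x = roundedSet η A y := by
  have hT : roundITilde A x = roundITilde A y := by
    ext v
    simp [roundITilde, hI]
  simp only [roundedSet, hT, hI, hJ]

/-- For fixed `A` rounding depends on `x` only through `I` and `J`, which take finitely many values,
each on a measurable set. -/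
lemma measurableSet_roundedSet (η : ℝ) (A : BipEdge n → Bool)
    (Q : Finset (BipVertex n) → Prop) :
    MeasurableSet {x : BipVertex n → ℝ | Q (roundedSet η A x)} := by
  classical
  have hset : {x : BipVertex n → ℝ | Q (roundedSet η A x)} =
      ⋃ a ∈ {a : Finset (BipVertex n) × Finset (BipVertex n) |
        ∃ y, roundI y = a.1 ∧ roundJ y = a.2 ∧ Q (roundedSet η A y)},
        {x | roundI x = a.1} ∩ {x | roundJ x = a.2} := by
    ext x
    simp only [Set.mem_ofPred_eq, Set.mem_iUnion, Set.mem_inter_iff, exists_prop, Prod.exists]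
    constructor
    · exact fun h => ⟨_, _, ⟨x, rfl, rfl, h⟩, rfl, rfl⟩
    · rintro ⟨I, J, ⟨y, hI, hJ, hy⟩, hxI, hxJ⟩
      rwa [roundedSet_congr A (hxI.trans hI.symm) (hxJ.trans hJ.symm)]
  have hfilter : ∀ (S : Finset (BipVertex n)) (P : ℝ → Prop), MeasurableSet {r | P r} →
      MeasurableSet {x : BipVertex n → ℝ | (Finset.univ.filter fun v => P (x v)) = S} := by
    intro S P hP
    have : {x : BipVertex n → ℝ | (Finset.univ.filter fun v => P (x v)) = S} =
        ⋂ v, {x | P (x v) ↔ v ∈ S} := by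
      ext x
      simp [Finset.ext_iff]
    rw [this]
    refine MeasurableSet.iInter fun v => ?_
    have hm : MeasurableSet ((fun x : BipVertex n → ℝ => x v) ⁻¹' {r | P r}) :=
      measurable_pi_apply v hP
    by_cases hv : v ∈ S
    · simpa [hv] using hm
    · have hc : {x : BipVertex n → ℝ | P (x v) ↔ v ∈ S} =
          ((fun x : BipVertex n → ℝ => x v) ⁻¹' {r | P r})ᶜ := by
        ext x
        simp [hv]
      rw [hc]
      exact hm.compl
  rw [hset]
  refine MeasurableSet.biUnion (Set.to_countable _) fun a _ => MeasurableSet.inter ?_ ?_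
  · convert hfilter a.1 (fun r => 1 ≤ r) measurableSet_Ici using 3 with x
    simp only [roundI]
  · convert hfilter a.2 (fun r => 1 / 2 < r ∧ r < 1) measurableSet_Ioo using 3 with x
    simp only [roundJ]
    congr!

lemma measurableSet_success {Ω : Type*} [MeasurableSpace Ω] {D : ℕ} {f : Ω → BipPoly n}
    (hf : IsRandomPoly D f) (η : ℝ) (Q : Finset (BipVertex n) → Prop) :
    MeasurableSet {z : (BipEdge n → Bool) × Ω | Q (roundedSet η z.1 ((f z.2).value z.1))} := by
  have hset : {z : (BipEdge n → Bool) × Ω | Q (roundedSet η z.1 ((f z.2).value z.1))} =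
      ⋃ A : BipEdge n → Bool, {A} ×ˢ {ω | Q (roundedSet η A ((f ω).value A))} := by
    ext ⟨A, ω⟩
    simp
  rw [hset]
  refine MeasurableSet.iUnion fun A => (MeasurableSet.singleton A).prod ?_
  exact (measurable_pi_lambda _ fun v => measurable_eval hf A v)
    (measurableSet_roundedSet η A Q)

lemma measurable_norm_sq {Ω : Type*} [MeasurableSpace Ω] {D : ℕ} {f : Ω → BipPoly n}
    (hf : IsRandomPoly D f) :
    Measurable fun z : (BipEdge n → Bool) × Ω =>
      ENNReal.ofReal (∑ v, (f z.2).value z.1 v ^ 2) := by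
  refine measurable_from_prod_countable_right fun A => ?_
  exact ENNReal.measurable_ofReal.comp
    (Finset.measurable_sum _ fun v _ => (measurable_eval hf A v).pow_const 2)

end Measurability

/-! ### Fixing the internal randomness -/

/-- The conditional second moment divided by `ξ (kl + kr)` plus the conditional failure probability
divided by `δ` has mean at most `2`, so some `ω` keeps both summands at most `2`. The division
requires `δ > 0`. -/
lemma Optimizes.exists_realization {Ω : Type*} [MeasurableSpace Ω] {P : Measure Ω}
    [IsProbabilityMeasure P] {n D : ℕ} {d kl kr δ ξ η : ℝ} {f : Ω → BipPoly n}
    (hf : IsRandomPoly D f) (h0 : 0 ≤ d) (hn : d ≤ n) (hk : 0 < ξ * (kl + kr)) (hδ : 0 < δ)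
    (h : Optimizes P n d kl kr δ ξ η f) :
    ∃ ω, cubeE (d / n) (fun A => ∑ v, (f ω).value A v ^ 2) ≤ 2 * (ξ * (kl + kr)) ∧
      cubePr (d / n) (fun A => ¬ (kl ≤ leftCard (roundedSet η A ((f ω).value A)) ∧
        kr ≤ rightCard (roundedSet η A ((f ω).value A)))) ≤ 2 * δ := by
  obtain ⟨hnorm, hprob⟩ := h
  set a := ξ * (kl + kr) with ha
  set G := {z : (BipEdge n → Bool) × Ω | kl ≤ leftCard (roundedSet η z.1 ((f z.2).value z.1)) ∧
         kr ≤ rightCard (roundedSet η z.1 ((f z.2).value z.1))} with hG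
  have hGm : MeasurableSet G :=
    measurableSet_success hf η fun S => kl ≤ leftCard S ∧ kr ≤ rightCard S
  have hGc : ((randomBip n d).prod P) Gᶜ ≤ ENNReal.ofReal δ := by
    rw [prob_compl_eq_one_sub hGm]
    refine (tsub_le_tsub_left hprob 1).trans ?_
    rw [tsub_le_iff_right, ← ENNReal.ofReal_one]
    calc ENNReal.ofReal 1 = ENNReal.ofReal (δ + (1 - δ)) := by ring_nf
      _ ≤ _ := ENNReal.ofReal_add_le
  rw [lintegral_prod_symm' _ (measurable_norm_sq hf)] at hnorm
  rw [Measure.prod_apply_symm hGm.compl] at hGc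
  set h1 : Ω → ℝ≥0∞ := fun ω => ∫⁻ A, ENNReal.ofReal (∑ v, (f ω).value A v ^ 2) ∂(randomBip n d)
    with hh1
  set h2 : Ω → ℝ≥0∞ := fun ω => randomBip n d ((fun A => (A, ω)) ⁻¹' Gᶜ) with hh2
  have hh1m : Measurable h1 := (measurable_norm_sq hf).lintegral_prod_left'
  have hh2m : Measurable h2 := measurable_measure_prodMk_right hGm.compl
  have ha0 : ENNReal.ofReal a ≠ 0 := by simpa using hk
  have hδ0 : ENNReal.ofReal δ ≠ 0 := by simpa using hδ
  have hint : ∫⁻ ω, (h1 ω / ENNReal.ofReal a + h2 ω / ENNReal.ofReal δ) ∂P ≤ 2 := by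
    rw [lintegral_add_left (hh1m.div_const _)]
    simp only [div_eq_mul_inv]
    rw [lintegral_mul_const _ hh1m, lintegral_mul_const _ hh2m, ← div_eq_mul_inv,
      ← div_eq_mul_inv, ← one_add_one_eq_two]
    exact add_le_add (ENNReal.div_le_of_le_mul (by simpa using hnorm))
      (ENNReal.div_le_of_le_mul (by simpa using hGc))
  obtain ⟨ω, hω⟩ := exists_le_lintegral (μ := P)
    (f := fun ω => h1 ω / ENNReal.ofReal a + h2 ω / ENNReal.ofReal δ)
    ((hh1m.div_const _).add (hh2m.div_const _)).aemeasurable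
  have hω2 := hω.trans hint
  have hsplit : ∀ {x : ℝ≥0∞} {b : ℝ}, 0 < b → x / ENNReal.ofReal b ≤ 2 →
      x ≤ ENNReal.ofReal (2 * b) := by
    intro x b hb hx
    rw [ENNReal.div_le_iff (by simpa using hb) ENNReal.ofReal_ne_top] at hx
    rwa [ENNReal.ofReal_mul zero_le_two, ENNReal.ofReal_ofNat]
  have hω1 := hsplit hk (le_self_add.trans hω2)
  have hω3 := hsplit hδ (le_add_self.trans hω2)
  refine ⟨ω, ?_, ?_⟩
  · have : h1 ω = _ := lintegral_randomBip h0 hn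
      (F := fun A => ∑ v, (f ω).value A v ^ 2) fun A => Finset.sum_nonneg fun v _ => sq_nonneg _
    rw [this] at hω1
    exact (ENNReal.ofReal_le_ofReal_iff (by positivity)).1 hω1
  · have : h2 ω = randomBip n d {A | ¬ (kl ≤ leftCard (roundedSet η A ((f ω).value A)) ∧
        kr ≤ rightCard (roundedSet η A ((f ω).value A)))} := rfl
    rw [this, randomBip_apply h0 hn] at hω3
    exact (ENNReal.ofReal_le_ofReal_iff (by positivity)).1 hω3

lemma leftCard_le {n : ℕ} (S : Finset (BipVertex n)) : leftCard S ≤ n := by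
  rw [leftCard_eq_card_toLeft]
  exact (Finset.card_le_univ _).trans (by simp)

lemma rightCard_le {n : ℕ} (S : Finset (BipVertex n)) : rightCard S ≤ n := by
  rw [rightCard_eq_card_toRight]
  exact (Finset.card_le_univ _).trans (by simp)

/-- No random low-degree polynomial finds balanced independent sets above the threshold. -/
lemma random_low_degree_hardness (ε : ℝ) (hε : 0 < ε) :
    ∃ d₀ : ℝ, 0 < d₀ ∧ ∀ d : ℝ, d₀ ≤ d →
      ∃ (n₀ : ℕ) (η C₁ C₂ : ℝ), 0 < n₀ ∧ 0 < η ∧ 0 < C₁ ∧ 0 < C₂ ∧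
      ∀ n : ℕ, n₀ ≤ n → ∀ kl kr : ℝ, (1 + ε) * (Real.log d / d) * n ≤ min kl kr →
      ∀ ξ : ℝ, 1 ≤ ξ → ∀ D : ℕ, 1 ≤ D → (D : ℝ) ≤ C₁ * n / (ξ * Real.log n) →
      ∀ δ : ℝ, 0 ≤ δ → δ ≤ Real.exp (-(C₂ * ξ * D * Real.log n)) →
      ∀ (Ω : Type*) [MeasurableSpace Ω] (P : MeasureTheory.Measure Ω)
        [MeasureTheory.IsProbabilityMeasure P] (f : Ω → BipPoly n),
        IsRandomPoly D f → ¬ Optimizes P n d kl kr δ ξ η f := by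
  -- A smaller `ε` only lowers the required set sizes, so the case `ε ≤ 1` suffices.
  set ε' := min ε 1 with hε'
  have hε'0 : 0 < ε' := lt_min hε one_pos
  obtain ⟨d₀, hd₀, H⟩ := low_degree_hardness hε'0 (min_le_right _ _)
  refine ⟨d₀, hd₀, fun d hd => ?_⟩
  obtain ⟨n₀, η, C₁, C₂, hn₀, hη, hC₁, hC₂, H⟩ := H d hd
  refine ⟨n₀, η, C₁, C₂, hn₀, hη, hC₁, hC₂, ?_⟩
  intro n hn kl kr hk ξ hξ D hD hDle δ _ hδ Ω _ P _ f hf hopt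
  obtain ⟨hdn, hΦ, H⟩ := H n hn
  obtain ⟨hδ3, H⟩ := H ξ hξ D hD hDle
  have hd0 : 0 < d := lt_of_lt_of_le hd₀ hd
  have hdn' : d ≤ n := by linarith
  have hp0 : 0 ≤ d / n := div_nonneg hd0.le (Nat.cast_nonneg n)
  have hp1 : d / n ≤ 1 := div_le_one_of_le₀ hdn' (Nat.cast_nonneg n)
  set δ' := Real.exp (-(C₂ * ξ * D * Real.log n)) with hδ'
  have hle : (1 + ε') * (Real.log d / d) * n ≤ min kl kr := by
    refine le_trans ?_ hk
    have h1 : 0 ≤ Real.log d / d * n := by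
      rw [mul_assoc] at hΦ
      exact (pos_of_mul_pos_right hΦ (by linarith)).le
    rw [mul_assoc, mul_assoc]
    exact mul_le_mul_of_nonneg_right (by linarith [min_le_left ε 1]) h1
  have hkl := hle.trans (min_le_left _ _)
  have hkr := hle.trans (min_le_right _ _)
  have hpos : 0 < ξ * (kl + kr) := mul_pos (by linarith) (by linarith)
  -- `δ` may be zero, so it is enlarged to the positive `δ'`.
  have hopt' : Optimizes P n d kl kr δ' ξ η f :=
    ⟨hopt.1, (ENNReal.ofReal_le_ofReal (by linarith)).trans hopt.2⟩
  obtain ⟨ω, hE, hfail⟩ := hopt'.exists_realization hf hd0.le hdn' hpos (Real.exp_pos _)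
  -- As `2 δ' < 1`, some graph succeeds, which forces `kl, kr ≤ n` and turns the moment bound into a
  -- multiple of `ξ n`.
  obtain ⟨A, hA1, hA2⟩ : ∃ A, kl ≤ leftCard (roundedSet η A ((f ω).value A)) ∧
        kr ≤ rightCard (roundedSet η A ((f ω).value A)) := by
    refine exists_of_cubePr_pos (p := d / n) ?_
    rw [cubePr_not] at hfail
    linarith
  have hl := hA1.trans (Nat.cast_le.2 (leftCard_le _))
  have hr := hA2.trans (Nat.cast_le.2 (rightCard_le _))
  refine H (fun A => (f ω).value A) (fun v => isLowDegree_eval (f ω v) (hf.degreeLE ω v)) ?_ ?_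
  · refine hE.trans ?_
    have hn0 : (0 : ℝ) ≤ n := Nat.cast_nonneg n
    nlinarith
  · refine (cubePr_mono hp0 hp1 fun A hA hsucc => hA
      ⟨Nat.ceil_le.2 (hkl.trans hsucc.1), Nat.ceil_le.2 (hkr.trans hsucc.2)⟩).trans
      (hfail.trans ?_)
    · have := Real.exp_pos (-(C₂ * ξ * D * Real.log n))
      linarith

/-! ### A degree-one polynomial below the threshold -/

section Algorithm

variable {n : ℕ}

/-- The degree-one map that selects `S` on the left and, within `T`, the vertices on the right
without neighbours in `S`. -/
noncomputable def greedyPoly (S T : Finset (Fin n)) : BipPoly n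
  | Sum.inl i => if i ∈ S then 1 else 0
  | Sum.inr j => if j ∈ T then 1 - ∑ i ∈ S, MvPolynomial.X (i, j) else 0

lemma greedyPoly_degreeLE (S T : Finset (Fin n)) : (greedyPoly S T).DegreeLE 1 := by
  rintro (i | j)
  · simp only [greedyPoly]
    split_ifs <;> simp
  · simp only [greedyPoly]
    split_ifs
    · refine (MvPolynomial.totalDegree_sub _ _).trans (max_le (by simp) ?_)
      refine MvPolynomial.totalDegree_finsetSum_le fun i _ => ?_
      simp
    · simp

/-- The number of neighbours of `j` in `S`. -/
noncomputable def nbrCount (S : Finset (Fin n)) (A : BipEdge n → Bool) (j : Fin n) : ℝ :=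
  ∑ i ∈ S, if A (i, j) = true then 1 else 0

lemma greedyPoly_value_inl (S T : Finset (Fin n)) (A : BipEdge n → Bool) (i : Fin n) :
    (greedyPoly S T).value A (Sum.inl i) = if i ∈ S then 1 else 0 := by
  simp only [BipPoly.value, greedyPoly]
  split_ifs <;> simp

lemma greedyPoly_value_inr (S T : Finset (Fin n)) (A : BipEdge n → Bool) (j : Fin n) :
    (greedyPoly S T).value A (Sum.inr j) = if j ∈ T then 1 - nbrCount S A j else 0 := by
  simp only [BipPoly.value, greedyPoly]
  split_ifs
  · simp [nbrCount, edgeVector]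
  · simp

/-- The vertices of `T` without neighbours in `S`. -/
def freeVertices (S T : Finset (Fin n)) (A : BipEdge n → Bool) : Finset (Fin n) :=
  T.filter fun j => ∀ i ∈ S, A (i, j) = false

lemma nbrCount_eq_zero {S : Finset (Fin n)} {A : BipEdge n → Bool} {j : Fin n}
    (h : ∀ i ∈ S, A (i, j) = false) : nbrCount S A j = 0 :=
  Finset.sum_eq_zero fun i hi => by simp [h i hi]

lemma one_le_nbrCount {S : Finset (Fin n)} {A : BipEdge n → Bool} {j : Fin n}
    (h : ¬ ∀ i ∈ S, A (i, j) = false) : 1 ≤ nbrCount S A j := by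
  push Not at h
  obtain ⟨i, hi, hA⟩ := h
  have := Finset.single_le_sum (f := fun i => if A (i, j) = true then (1 : ℝ) else 0)
    (fun i _ => by split_ifs <;> norm_num) hi
  have hA' : A (i, j) = true := by simpa using hA
  rw [nbrCount]
  simpa only [hA', if_true] using this

lemma roundI_greedyPoly (S T : Finset (Fin n)) (A : BipEdge n → Bool) :
    roundI ((greedyPoly S T).value A) = S.disjSum (freeVertices S T A) := by
  classical
  ext (i | j)
  · simp only [roundI, Finset.mem_filter, Finset.mem_univ, true_and, greedyPoly_value_inl,
      Finset.inl_mem_disjSum]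
    split_ifs with h <;> simp [h]
  · simp only [roundI, Finset.mem_filter, Finset.mem_univ, true_and, greedyPoly_value_inr,
      Finset.inr_mem_disjSum, freeVertices]
    by_cases hT : j ∈ T
    · by_cases hf : ∀ i ∈ S, A (i, j) = false
      · simp only [hT, if_true, nbrCount_eq_zero hf, sub_zero, le_refl, true_and, true_iff]
        exact hf
      · have := one_le_nbrCount hf
        simp only [hT, if_true, hf, and_false, iff_false, not_le]
        linarith
    · simp only [hT, if_false, false_and, iff_false]
      norm_num

lemma roundJ_greedyPoly (S T : Finset (Fin n)) (A : BipEdge n → Bool) :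
    roundJ ((greedyPoly S T).value A) = ∅ := by
  classical
  rw [roundJ, Finset.filter_eq_empty_iff]
  rintro (i | j) -
  · rw [greedyPoly_value_inl]
    split_ifs <;> norm_num
  · rw [greedyPoly_value_inr]
    split_ifs
    · by_cases hf : ∀ i ∈ S, A (i, j) = false
      · rw [nbrCount_eq_zero hf]; norm_num
      · have := one_le_nbrCount hf
        intro h
        linarith
    · norm_num

lemma roundedSet_greedyPoly (S T : Finset (Fin n)) (A : BipEdge n → Bool) :
    roundedSet 0 A ((greedyPoly S T).value A) = S.disjSum (freeVertices S T A) := by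
  classical
  have hT : roundITilde A ((greedyPoly S T).value A) = S.disjSum (freeVertices S T A) := by
    rw [← roundI_greedyPoly S T A, roundITilde, Finset.filter_eq_self]
    rw [roundI_greedyPoly S T A]
    have hfree : ∀ i ∈ S, ∀ j ∈ freeVertices S T A, A (i, j) = false := fun i hi j hj =>
      (Finset.mem_filter.1 hj).2 i hi
    rintro v hv w hw (⟨i, j, rfl, rfl, hA⟩ | ⟨i, j, rfl, rfl, hA⟩)
    · rw [Finset.inl_mem_disjSum] at hv
      rw [Finset.inr_mem_disjSum] at hw
      simp [hfree i hv j hw] at hA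
    · rw [Finset.inl_mem_disjSum] at hw
      rw [Finset.inr_mem_disjSum] at hv
      simp [hfree i hw j hv] at hA
  rw [roundedSet, if_pos]
  · exact hT
  · rw [hT, roundI_greedyPoly, roundJ_greedyPoly]
    simp

lemma leftCard_disjSum (S T : Finset (Fin n)) :
    leftCard (S.disjSum T : Finset (BipVertex n)) = S.card := by
  rw [leftCard_eq_card_toLeft, Finset.toLeft_disjSum]

lemma rightCard_disjSum (S T : Finset (Fin n)) :
    rightCard (S.disjSum T : Finset (BipVertex n)) = T.card := by
  rw [rightCard_eq_card_toRight, Finset.toRight_disjSum]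

variable {p : ℝ}

/-- The centred count is a sum of characters of singletons. -/
lemma cubeE_nbrCount_sub_sq (S : Finset (Fin n)) (j : Fin n) :
    cubeE p (fun A => (nbrCount S A j - S.card * p) ^ 2) = S.card * (p * (1 - p)) := by
  have h := cubeE_sq_sum_char (p := p) S (fun _ => 1)
    (fun i => ({(i, j)} : Finset (BipEdge n))) (by
      intro a _ b _ hab
      simpa using hab)
  simp only [cubeChar, Finset.prod_singleton, Finset.card_singleton, one_pow, one_mul, pow_one,
    Finset.sum_const, nsmul_eq_mul, Finset.sum_sub_distrib] at h
  exact h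

lemma cubeE_greedyPoly_norm_sq_le (h0 : 0 ≤ p) (h1 : p ≤ 1) {d : ℝ} (S T : Finset (Fin n))
    (hS : S.card * p ≤ d) :
    cubeE p (fun A => ∑ v, (greedyPoly S T).value A v ^ 2) ≤
      S.card + T.card * (2 + 2 * d + 2 * d ^ 2) := by
  have hSp : 0 ≤ S.card * p := by positivity
  have hval : ∀ A : BipEdge n → Bool, ∑ v, (greedyPoly S T).value A v ^ 2 =
      S.card + ∑ j ∈ T, (1 - nbrCount S A j) ^ 2 := by
    intro A
    rw [Fintype.sum_sum_type]
    simp only [greedyPoly_value_inl, greedyPoly_value_inr, ite_pow, one_pow, ne_eq,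
      OfNat.ofNat_ne_zero, not_false_eq_true, zero_pow, Finset.sum_ite_mem, Finset.univ_inter,
      Finset.sum_const, nsmul_eq_mul, mul_one]
  simp only [hval]
  rw [cubeE_add, cubeE_const, cubeE_sum]
  refine add_le_add le_rfl ?_
  rw [← nsmul_eq_mul]
  refine Finset.sum_le_card_nsmul _ _ _ fun j _ => ?_
  calc cubeE p (fun A => (1 - nbrCount S A j) ^ 2)
      ≤ cubeE p (fun A => (2 + 2 * d ^ 2) + 2 * (nbrCount S A j - S.card * p) ^ 2) := by
        refine cubeE_mono h0 h1 fun A => ?_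
        -- `(a - b) ^ 2 ≤ 2 a ^ 2 + 2 b ^ 2` with `a = 1 - |S| p`, `b` the centred count, and `a ^ 2
        -- ≤ 1 + d ^ 2`.
        nlinarith [sq_nonneg (1 - S.card * p + (nbrCount S A j - S.card * p))]
    _ = (2 + 2 * d ^ 2) + 2 * (S.card * (p * (1 - p))) := by
        rw [cubeE_add, cubeE_const, cubeE_mul_left, cubeE_nbrCount_sub_sq]
    _ ≤ _ := by nlinarith

/-- The vertex `j` on the right has no neighbours in `S`. -/
def IsFree (S : Finset (Fin n)) (j : Fin n) (A : BipEdge n → Bool) : Prop :=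
  ∀ i ∈ S, A (i, j) = false

lemma cubePr_isFree (S : Finset (Fin n)) (j : Fin n) :
    cubePr p (IsFree S j) = (1 - p) ^ S.card := by
  have h := cubePr_forall_false (p := p) (S ×ˢ ({j} : Finset (Fin n)))
  rw [Finset.card_product, Finset.card_singleton, mul_one] at h
  rw [← h]
  congr 1
  ext A
  simp [IsFree]

lemma cubePr_isFree_and (S : Finset (Fin n)) {j k : Fin n} (hjk : j ≠ k) :
    cubePr p (fun A => IsFree S j A ∧ IsFree S k A) = ((1 - p) ^ S.card) ^ 2 := by
  have h := cubePr_forall_false (p := p) (S ×ˢ ({j, k} : Finset (Fin n)))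
  rw [Finset.card_product, Finset.card_pair hjk, pow_mul] at h
  rw [← h]
  congr 1
  ext A
  simp only [IsFree, Finset.mem_product, Finset.mem_insert, Finset.mem_singleton, Prod.forall]
  constructor
  · rintro ⟨h1, h2⟩ i _ ⟨hi, rfl | rfl⟩
    · exact h1 i hi
    · exact h2 i hi
  · exact fun h => ⟨fun i hi => h i j ⟨hi, Or.inl rfl⟩, fun i hi => h i k ⟨hi, Or.inr rfl⟩⟩

-- Different right vertices use disjoint sets of pairs, so the covariances vanish. Bernoulli's
-- inequality bounds each variance by `Q - Q ^ 2 ≤ 1 - Q ≤ |S| p`, which is small even when `T` is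
-- small.
open Classical in
lemma cubeE_freeVertices_sub_sq_le (h0 : 0 ≤ p) (h1 : p ≤ 1) (S T : Finset (Fin n)) :
    cubeE p (fun A => ((freeVertices S T A).card - T.card * (1 - p) ^ S.card : ℝ) ^ 2) ≤
      T.card * (S.card * p) := by
  set Q := (1 - p) ^ S.card with hQ
  have h1' : 0 ≤ 1 - p := by linarith
  have hQ0 : 0 ≤ Q := pow_nonneg h1' _
  set Y : Fin n → (BipEdge n → Bool) → ℝ := fun j A => if IsFree S j A then 1 else 0 with hY
  have hcard : ∀ A, ((freeVertices S T A).card : ℝ) = ∑ j ∈ T, Y j A := by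
    intro A
    have hfree : freeVertices S T A = T.filter fun j => IsFree S j A := by
      ext j
      simp only [freeVertices, Finset.mem_filter]
      rfl
    rw [hfree, Finset.card_filter]
    push_cast
    rfl
  have hEY : ∀ j, cubeE p (Y j) = Q := fun j => cubePr_isFree S j
  have hYY : ∀ j k, j ≠ k → cubeE p (fun A => Y j A * Y k A) = Q ^ 2 := by
    intro j k hjk
    rw [hQ, ← cubePr_isFree_and S hjk, cubePr]
    congr 1
    ext A
    by_cases ha : IsFree S j A <;> by_cases hb : IsFree S k A <;> simp [hY, ha, hb]
  have hYjj : ∀ j A, Y j A * Y j A = Y j A := by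
    intro j A
    simp only [hY]
    split_ifs <;> simp
  have hcov : ∀ j k, cubeE p (fun A => (Y j A - Q) * (Y k A - Q)) =
      if j = k then Q - Q ^ 2 else 0 := by
    intro j k
    have hexp : ∀ A, (Y j A - Q) * (Y k A - Q) =
        (Y j A * Y k A - Q * Y j A) - (Q * Y k A - Q ^ 2) := fun A => by ring
    simp only [hexp]
    rw [cubeE_sub, cubeE_sub, cubeE_sub, cubeE_const, cubeE_mul_left, cubeE_mul_left, hEY, hEY]
    split_ifs with hjk
    · subst hjk
      simp only [hYjj, hEY]
      ring
    · rw [hYY j k hjk]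
      ring
  have hsq : ∀ A, ((freeVertices S T A).card - T.card * Q : ℝ) ^ 2 =
      ∑ j ∈ T, ∑ k ∈ T, (Y j A - Q) * (Y k A - Q) := by
    intro A
    rw [← Finset.sum_mul_sum, Finset.sum_sub_distrib, hcard, Finset.sum_const, nsmul_eq_mul, sq]
  simp only [hsq, cubeE_sum, hcov]
  rw [← nsmul_eq_mul]
  refine Finset.sum_le_card_nsmul _ _ _ fun j hj => ?_
  rw [Finset.sum_ite_eq, if_pos hj]
  have hQ1 : Q ≤ 1 := pow_le_one₀ h1' (by linarith)
  have hbern : 1 - S.card * p ≤ Q := by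
    have := one_add_mul_le_pow (show (-2 : ℝ) ≤ -p by linarith) S.card
    rw [← sub_eq_add_neg] at this
    linarith
  nlinarith

/-- Chebyshev. Thanks to `|S| ≤ |T|` the variance is at most `p |T| ^ 2`, so the bound does not
depend on the sizes. -/
lemma cubePr_freeVertices_lt_le (h0 : 0 ≤ p) (h1 : p ≤ 1) (S T : Finset (Fin n)) {c kr : ℝ}
    (hc : 0 < c) (hT : 0 < T.card) (hST : S.card ≤ T.card)
    (hkr : kr + c * T.card ≤ T.card * (1 - p) ^ S.card) :
    cubePr p (fun A => ¬ kr ≤ (freeVertices S T A).card) ≤ p / c ^ 2 := by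
  have hT' : (0 : ℝ) < T.card := by exact_mod_cast hT
  have hST' : (S.card : ℝ) ≤ T.card := by exact_mod_cast hST
  have hcT : 0 < c * T.card := mul_pos hc hT'
  refine (cubePr_mono h0 h1 (E' := fun A => (c * T.card) ^ 2 ≤
    ((freeVertices S T A).card - T.card * (1 - p) ^ S.card : ℝ) ^ 2) fun A hA => ?_).trans ?_
  · push Not at hA
    nlinarith
  refine (cubePr_markov h0 h1 (fun A => sq_nonneg _) (by positivity)).trans ?_
  rw [div_le_div_iff₀ (by positivity) (by positivity)]
  have h2 := cubeE_freeVertices_sub_sq_le h0 h1 S T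
  calc _ ≤ T.card * (S.card * p) * c ^ 2 := mul_le_mul_of_nonneg_right h2 (by positivity)
    _ ≤ T.card * (T.card * p) * c ^ 2 := by gcongr
    _ = _ := by ring

lemma detOptimizes_of_cube {d kl kr δ ξ η : ℝ} (h0 : 0 ≤ d) (hn : d ≤ n) {F : BipPoly n}
    (hE : cubeE (d / n) (fun A => ∑ v, F.value A v ^ 2) ≤ ξ * (kl + kr))
    (hP : 1 - δ ≤ cubePr (d / n) fun A => kl ≤ leftCard (roundedSet η A (F.value A)) ∧
      kr ≤ rightCard (roundedSet η A (F.value A))) :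
    DetOptimizes n d kl kr δ ξ η F := by
  refine ⟨?_, ?_⟩
  · rw [Measure.prod_dirac, lintegral_map (measurable_of_finite _) (by fun_prop)]
    simp only
    rw [lintegral_randomBip h0 hn (F := fun A => ∑ v, F.value A v ^ 2)
      fun A => Finset.sum_nonneg fun v _ => sq_nonneg _]
    exact ENNReal.ofReal_le_ofReal hE
  · rw [Measure.prod_dirac, Measure.map_apply (by fun_prop) (Set.toFinite _).measurableSet]
    refine (ENNReal.ofReal_le_ofReal hP).trans (le_of_eq ?_)
    rw [← randomBip_apply h0 hn]
    rfl

-- From `log (1 - x) ≥ -x / (1 - x)` the power is at least `exp (-(s d / n) / (1 - d / n))`, whose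
-- worst case tends to `d ^ (ε - 1)`. The `+ 1` accommodates the rounding of `kl` up to an integer.
open Filter Topology in
lemma eventually_le_one_sub_pow {ε d : ℝ} (hε : 0 < ε) (hd : 1 ≤ d) :
    ∀ᶠ n : ℕ in atTop, ∀ s : ℕ, (s : ℝ) ≤ (1 - ε) * (Real.log d / d) * n + 1 →
      (1 - ε / 2) * d ^ (ε - 1) ≤ (1 - d / n) ^ s := by
  have hd0 : 0 < d := by linarith
  have hdn : Tendsto (fun n : ℕ => d / (n : ℝ)) atTop (𝓝 0) :=
    tendsto_const_div_atTop_nhds_zero_nat d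
  have hlim : Tendsto (fun n : ℕ => Real.exp (-(((1 - ε) * Real.log d + d / n) / (1 - d / n))))
      atTop (𝓝 (Real.exp (-(((1 - ε) * Real.log d + 0) / (1 - 0))))) := by
    refine (Real.continuous_exp.tendsto _).comp (Tendsto.neg (Tendsto.div ?_ ?_ (by norm_num)))
    · exact tendsto_const_nhds.add hdn
    · exact tendsto_const_nhds.sub hdn
  have ha : Real.exp (-(((1 - ε) * Real.log d + 0) / (1 - 0))) = d ^ (ε - 1) := by
    rw [Real.rpow_def_of_pos hd0]
    congr 1
    ring
  rw [ha] at hlim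
  have hapos : 0 < d ^ (ε - 1) := Real.rpow_pos_of_pos hd0 _
  have hev := hlim.eventually_const_le (show (1 - ε / 2) * d ^ (ε - 1) < d ^ (ε - 1) by nlinarith)
  filter_upwards [hev, hdn.eventually_lt_const (show (0 : ℝ) < 1 by norm_num),
    eventually_ge_atTop 1] with n h1 h2 h3 s hs
  have hn0 : (0 : ℝ) < n := by exact_mod_cast h3
  have hp : 0 < 1 - d / (n : ℝ) := by linarith
  refine h1.trans ?_
  have hlog : 1 - (1 - d / (n : ℝ))⁻¹ ≤ Real.log (1 - d / n) := Real.one_sub_inv_le_log_of_pos hp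
  have hlog' : -(d / n / (1 - d / n)) ≤ Real.log (1 - d / (n : ℝ)) := by
    refine le_trans (le_of_eq ?_) hlog
    rw [← one_div, eq_sub_iff_add_eq, neg_add_eq_iff_eq_add, div_add_one hp.ne']
    ring
  rw [← Real.exp_log hp, ← Real.exp_nat_mul, Real.exp_le_exp]
  simp only [Real.exp_log hp]
  have hsp : (s : ℝ) * (d / n) ≤ (1 - ε) * Real.log d + d / n := by
    have h4 := mul_le_mul_of_nonneg_right hs (show 0 ≤ d / (n : ℝ) by positivity)
    refine h4.trans (le_of_eq ?_)
    field_simp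
  calc -(((1 - ε) * Real.log d + d / n) / (1 - d / n)) ≤ -(s * (d / n) / (1 - d / n)) := by
        refine neg_le_neg ?_
        gcongr
    _ = s * -(d / n / (1 - d / n)) := by ring
    _ ≤ _ := mul_le_mul_of_nonneg_left hlog' (Nat.cast_nonneg s)

open Filter Topology in
/-- A degree-one polynomial finds independent sets below the threshold. -/
lemma degree_one_optimizes {ε : ℝ} (hε : 0 < ε) (d : ℝ) (hd : 0 < d) :
    ∃ ξ : ℝ, 1 ≤ ξ ∧ ∃ δ : ℕ → ℝ,
      (∀ n, δ n ∈ Set.Icc (0 : ℝ) 1) ∧ Tendsto δ atTop (𝓝 0) ∧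
      ∀ n : ℕ, d ≤ n → ∀ kl kr : ℝ, 0 ≤ kl → 0 ≤ kr → 1 ≤ kl + kr →
        kl ≤ (1 - ε) * (Real.log d / d) * n →
        kr ≤ (1 - ε) * d ^ (ε - 1) * n →
        ∃ F : BipPoly n, F.DegreeLE 1 ∧ DetOptimizes n d kl kr (δ n) ξ 0 F := by
  have hapos : 0 < d ^ (ε - 1) := Real.rpow_pos_of_pos hd _
  by_cases hcase : ε < 1 ∧ 1 ≤ d
  swap
  -- Vacuous: if `ε ≥ 1` or `d < 1`, no admissible `kl`, `kr` exist.
  · refine ⟨1, le_rfl, fun _ => 0, fun _ => by simp, tendsto_const_nhds, ?_⟩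
    intro n hn kl kr hkl hkr hk1 hl hr
    exfalso
    have hn0 : (0 : ℝ) < n := by linarith
    by_cases hε1 : ε < 1
    · have hd1 : d < 1 := by
        by_contra hc
        exact hcase ⟨hε1, not_lt.1 hc⟩
      have hlog : Real.log d / d < 0 := div_neg_of_neg_of_pos (Real.log_neg hd hd1) hd
      have : (1 - ε) * (Real.log d / d) * n < 0 :=
        mul_neg_of_neg_of_pos (mul_neg_of_pos_of_neg (by linarith) hlog) hn0
      linarith
    · push Not at hε1
      rcases hε1.lt_or_eq with hlt | rfl
      · have : (1 - ε) * d ^ (ε - 1) * n < 0 :=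
          mul_neg_of_neg_of_pos (mul_neg_of_neg_of_pos (by linarith) hapos) hn0
        linarith
      · simp only [sub_self, zero_mul] at hl hr
        linarith
  obtain ⟨hε1, hd1⟩ := hcase
  set a := d ^ (ε - 1) with ha
  have ha1 : a ≤ 1 := Real.rpow_le_one_of_one_le_of_nonpos hd1 (by linarith)
  obtain ⟨n₁, hn₁⟩ := eventually_atTop.1 (eventually_le_one_sub_pow hε hd1)
  set c := ε * a / 4 with hc
  have hc0 : 0 < c := by positivity
  have h4a : 4 ≤ 4 / a := by
    rw [le_div_iff₀ hapos]
    linarith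
  -- The Chebyshev bound, replaced by the trivial value `1` while `n` is too small for the
  -- asymptotics.
  set δ : ℕ → ℝ := fun n => if n < n₁ then 1 else min 1 (d / n / c ^ 2) with hδ
  refine ⟨2 + (2 * (4 / a) + 1) * (2 + 2 * d + 2 * d ^ 2), ?_, δ, ?_, ?_, ?_⟩
  · have : 0 ≤ (2 * (4 / a) + 1) * (2 + 2 * d + 2 * d ^ 2) := by positivity
    linarith
  · intro n
    simp only [hδ]
    split_ifs
    · simp
    · exact ⟨le_min zero_le_one (by positivity), min_le_left _ _⟩
  · have h1 : Tendsto (fun n : ℕ => d / (n : ℝ) / c ^ 2) atTop (𝓝 0) := by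
      simpa using (tendsto_const_div_atTop_nhds_zero_nat d).div_const (c ^ 2)
    refine squeeze_zero' (Eventually.of_forall fun n => ?_) ?_ h1
    · simp only [hδ]
      split_ifs
      · norm_num
      · exact le_min zero_le_one (by positivity)
    · filter_upwards [eventually_ge_atTop n₁] with n hn
      simp only [hδ, if_neg (not_lt.2 hn)]
      exact min_le_right _ _
  intro n hn kl kr hkl hkr hk1 hl hr
  have hn0 : (0 : ℝ) < n := by linarith
  have hp0 : 0 ≤ d / (n : ℝ) := by positivity
  have hp1 : d / (n : ℝ) ≤ 1 := div_le_one_of_le₀ hn hn0.le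
  set s := ⌈kl⌉₊ with hs
  have hskl : kl ≤ s := Nat.le_ceil kl
  have hskl' : (s : ℝ) ≤ kl + 1 := (Nat.ceil_lt_add_one hkl).le
  -- Large enough that `|T|` vertices contain well over `kr` free ones on average and that `|S| ≤
  -- |T|`, yet of order `kl + kr` so that the norm is controlled.
  set u := 4 / a * (s + kr) with hu
  have hsk1 : 1 ≤ s + kr := by linarith
  have hu0 : 0 ≤ u := by positivity
  set t := min n ⌈u⌉₊ with ht
  have hsn : s ≤ n := by
    refine Nat.ceil_le.2 (hl.trans ?_)
    have h1 : Real.log d / d ≤ 1 := by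
      rw [div_le_one hd]
      linarith [Real.log_le_sub_one_of_pos hd]
    have h2 : 0 ≤ Real.log d / d := div_nonneg (Real.log_nonneg hd1) hd.le
    have h3 : (1 - ε) * (Real.log d / d) ≤ 1 := by nlinarith
    nlinarith
  have hst : s ≤ t := by
    refine le_min hsn ?_
    have : (s : ℝ) ≤ ⌈u⌉₊ := le_trans (by nlinarith) (Nat.le_ceil u)
    exact_mod_cast this
  have ht0 : 0 < t := by
    refine lt_min (by exact_mod_cast hn0) (Nat.ceil_pos.2 (by positivity))
  obtain ⟨S, -, hS⟩ := Finset.exists_subset_card_eq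
    (show s ≤ (Finset.univ : Finset (Fin n)).card by simpa using hsn)
  obtain ⟨T, -, hT⟩ := Finset.exists_subset_card_eq
    (show t ≤ (Finset.univ : Finset (Fin n)).card by simp [ht])
  have ht_le : (t : ℝ) ≤ u + 1 :=
    le_trans (Nat.cast_le.2 (min_le_right _ _)) (Nat.ceil_lt_add_one hu0).le
  refine ⟨greedyPoly S T, greedyPoly_degreeLE S T, detOptimizes_of_cube hd.le hn ?_ ?_⟩
  · refine (cubeE_greedyPoly_norm_sq_le (d := d) hp0 hp1 S T ?_).trans ?_
    · rw [hS]
      calc (s : ℝ) * (d / n) ≤ n * (d / n) :=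
            mul_le_mul_of_nonneg_right (by exact_mod_cast hsn) hp0
        _ = d := by field_simp
    · rw [hS, hT, add_mul]
      refine add_le_add (by linarith) ?_
      have h1 : (t : ℝ) ≤ (2 * (4 / a) + 1) * (kl + kr) := by
        refine ht_le.trans ?_
        rw [hu]
        nlinarith
      calc (t : ℝ) * (2 + 2 * d + 2 * d ^ 2) ≤
          (2 * (4 / a) + 1) * (kl + kr) * (2 + 2 * d + 2 * d ^ 2) :=
            mul_le_mul_of_nonneg_right h1 (by positivity)
        _ = _ := by ring
  · simp only [roundedSet_greedyPoly, leftCard_disjSum, rightCard_disjSum, hS, hskl, true_and]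
    simp only [hδ]
    split_ifs with hnn
    · rw [sub_self]
      exact cubePr_nonneg hp0 hp1 _
    · have hQ := hn₁ n (not_lt.1 hnn) s (by linarith)
      have hmain : kr + c * t ≤ t * (1 - d / n) ^ s := by
        have htQ := mul_le_mul_of_nonneg_left hQ (Nat.cast_nonneg t)
        refine le_trans ?_ htQ
        -- If `t = n`, the margin is the gap between `1 - ε` and `1 - ε / 2`, of which `c` uses `ε /
        -- 4`. Otherwise `kr ≤ a t / 4`, and `1 / 4 + ε / 4 ≤ 1 - ε / 2` because `ε < 1`.
        rcases le_total n ⌈u⌉₊ with h | h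
        · rw [ht, min_eq_left h, hc]
          have : 0 ≤ ε * a * n := by positivity
          nlinarith
        · rw [ht, min_eq_right h, hc]
          have h1 : 4 * (s + kr) ≤ a * ⌈u⌉₊ := by
            have := mul_le_mul_of_nonneg_left (Nat.le_ceil u) hapos.le
            refine le_trans (le_of_eq ?_) this
            rw [hu]
            field_simp
          have h2 : kr ≤ a * ⌈u⌉₊ / 4 := by
            have : (0 : ℝ) ≤ s := Nat.cast_nonneg s
            linarith
          have h3 : 0 ≤ a * (⌈u⌉₊ : ℝ) := by positivity
          nlinarith
      have h := cubePr_freeVertices_lt_le (kr := kr) hp0 hp1 S T hc0 (by rw [hT]; exact ht0)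
        (by rw [hS, hT]; exact hst) (by rw [hS, hT]; exact hmain)
      rw [cubePr_not] at h
      have h0 := cubePr_nonneg hp0 hp1 fun A => kr ≤ ((freeVertices S T A).card : ℝ)
      rcases min_cases 1 (d / n / c ^ 2) with ⟨h1, -⟩ | ⟨h1, -⟩ <;> rw [h1] <;> linarith

end Algorithm

theorem theorem1p6 (ε : ℝ) (hε : 0 < ε) :
    (∀ d : ℝ, 0 < d → ∃ ξ : ℝ, 1 ≤ ξ ∧ ∃ δ : ℕ → ℝ,
      (∀ n, δ n ∈ Set.Icc (0 : ℝ) 1) ∧ Filter.Tendsto δ Filter.atTop (nhds 0) ∧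
      ∀ n : ℕ, d ≤ n → ∀ kl kr : ℝ, 0 ≤ kl → 0 ≤ kr → 1 ≤ kl + kr →
        kl ≤ (1 - ε) * (Real.log d / d) * n →
        kr ≤ (1 - ε) * d ^ (ε - 1) * n →
        ∃ F : BipPoly n, F.DegreeLE 1 ∧ DetOptimizes n d kl kr (δ n) ξ 0 F) ∧
    (∃ d₀ : ℝ, 0 < d₀ ∧ ∀ d : ℝ, d₀ ≤ d →
      ∃ (n₀ : ℕ) (η C₁ C₂ : ℝ), 0 < n₀ ∧ 0 < η ∧ 0 < C₁ ∧ 0 < C₂ ∧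
      ∀ n : ℕ, n₀ ≤ n → ∀ kl kr : ℝ, (1 + ε) * (Real.log d / d) * n ≤ min kl kr →
      ∀ ξ : ℝ, 1 ≤ ξ → ∀ D : ℕ, 1 ≤ D → (D : ℝ) ≤ C₁ * n / (ξ * Real.log n) →
      ∀ δ : ℝ, 0 ≤ δ → δ ≤ Real.exp (-(C₂ * ξ * D * Real.log n)) →
      ∀ (Ω : Type*) [MeasurableSpace Ω] (P : MeasureTheory.Measure Ω)
        [MeasureTheory.IsProbabilityMeasure P] (f : Ω → BipPoly n),
        IsRandomPoly D f → ¬ Optimizes P n d kl kr δ ξ η f) := by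
  exact ⟨fun d hd => degree_one_optimizes hε d hd, random_low_degree_hardness ε hε⟩
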